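/- Let $(M,g)$ be a real-analytic $n$-dimensional manifold with a real-analytic pseudo-Riemannian metric $g$ of arbitrary signature. A semicolon denotes the Levi-Civita covariant derivative, indices are raised with $g$, and square brackets denote antisymmetrization. All statements below are tensorial and are read in an arbitrary analytic chart of $M$. A *Ricci candidate* is a symmetric 2-tensor field $\mathcal R_{ab}=\mathcal R_{ba}$. A *Riemann candidate* is a 4-tensor field with $\mathcal R_{abcd}=\mathcal R_{[ab][cd]}$ and $\mathcal R_{a[bcd]}=0$; its Ricci trace is $\mathcal R_{ab}=\mathcal R^{c}{}_{acb}$. (1) Every analytic Ricci candidate $\mathcal R_{ab}$ has local potentials: every point of $M$ has an open neighbourhood $U$ (inside a given chart domain) carrying an analytic double $(1,2)$-form $Y_{cab}=Y_{c[ab]}$ with $Y_{[abc]}=0$ and an analytic 1-form $Z_a$ such that, on $U$, $$\mathcal R_{ab}=\tfrac12\left(Y_{abe}{}^{;e}+Y_{bae}{}^{;e}+Z_{a;b}+Z_{b;a}\right).\qquad (*)$$ (2) Let the Ricci candidate $\mathcal R_{ab}$ be the Ricci trace, on an open set $U$ contained in a chart domain, of a Riemann candidate $\mathcal R_{abcd}$,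 and suppose that $\mathcal R_{abcd}$ has potentials on $U$, that is, an analytic double $(2,3)$-form $Y_{abcde}=Y_{[ab][cde]}$ with $Y_{a[bcde]}=0$ and an analytic double $(2,1)$-form $Z_{abc}=Z_{[ab]c}$ with $Z_{[abc]}=0$ such that, on $U$, $$\mathcal R_{abcd}=\tfrac12\left(Y_{abcde}{}^{;e}+Y_{cdabe}{}^{;e}+2Z_{ab[c;d]}+2Z_{cd[a;b]}\right).$$ Then $$Y^{c}{}_{ab}=Y^{ec}{}_{eab}+Z_{ab}{}^{c},\qquad Z_a=Z_{ea}{}^{e}$$ define a pair of potentials of $\mathcal R_{ab}$ on $U$: $Y_{cab}$ is an analytic double $(1,2)$-form with $Y_{[abc]}=0$, $Z_a$ is an analytic 1-form, and $(*)$ holds on $U$. -/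

import Mathlib

open scoped Manifold ContDiff

noncomputable section

/-- The model space `ℝⁿ`. -/
abbrev Model (n : ℕ) : Type := EuclideanSpace ℝ (Fin n)

/-- A (not necessarily continuous) covariant tensor field of rank `k` on an `n`-manifold `M`:
at every point `x` a multilinear form in `k` tangent vectors at `x`. -/
abbrev TensorField (n k : ℕ) (M : Type*) [TopologicalSpace M] [ChartedSpace (Model n) M] :=
  (x : M) → MultilinearMap ℝ (fun _ : Fin k => TangentSpace (𝓡 n) x) ℝ

section Coordinates

variable {n k : ℕ} {M : Type*} [TopologicalSpace M] [ChartedSpace (Model n) M]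

/-- The coordinate vector field `∂ᵢ` of the chart `φ`, at the point with coordinates `u`. -/
def coordVec (φ : OpenPartialHomeomorph M (Model n)) (u : Model n) (i : Fin n) :
    TangentSpace (𝓡 n) (φ.symm u) :=
  mfderiv (𝓡 n) (𝓡 n) φ.symm u (EuclideanSpace.single i (1 : ℝ))

/-- The components `T_{i₁…iₖ} = T(∂_{i₁}, …, ∂_{iₖ})` of a covariant tensor field in the chart
`φ`, as functions of the coordinates `u` (meaningful for `u ∈ φ.target`). -/
def comp (φ : OpenPartialHomeomorph M (Model n)) (T : TensorField n k M)
    (u : Model n) (I : Fin k → Fin n) : ℝ :=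
  T (φ.symm u) (fun s => coordVec φ u (I s))

/-- The tensor field `T` has real-analytic components in the chart `φ`, at every point of `U`. -/
def AnalyticInChart (φ : OpenPartialHomeomorph M (Model n)) (U : Set M)
    (T : TensorField n k M) : Prop :=
  ∀ I : Fin k → Fin n, ∀ x ∈ U, AnalyticAt ℝ (fun u => comp φ T u I) (φ x)

/-- A tensor field is analytic on `M` if its components are analytic in every chart of the
maximal analytic atlas. -/
def IsAnalyticField (T : TensorField n k M) : Prop :=
  ∀ φ ∈ IsManifold.maximalAtlas (𝓡 n) ω M, AnalyticInChart φ φ.source T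

end Coordinates

/-- An analytic pseudo-Riemannian metric (of arbitrary signature). -/
structure AnalyticMetric (n : ℕ) (M : Type*) [TopologicalSpace M]
    [ChartedSpace (Model n) M] where
  field : TensorField n 2 M
  symm : ∀ (x : M) (v w : TangentSpace (𝓡 n) x), field x ![v, w] = field x ![w, v]
  nondegenerate : ∀ (x : M) (v : TangentSpace (𝓡 n) x),
    (∀ w : TangentSpace (𝓡 n) x, field x ![v, w] = 0) → v = 0
  analytic : IsAnalyticField field

section Connection

variable {n k : ℕ} {M : Type*} [TopologicalSpace M] [ChartedSpace (Model n) M]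

/-- The partial derivative `∂ⱼ f` at `u`. -/
def pd (j : Fin n) (f : Model n → ℝ) (u : Model n) : ℝ :=
  fderiv ℝ f u (EuclideanSpace.single j (1 : ℝ))

/-- The components `g_{ij}` of the metric in the chart `φ`. -/
def gLow (g : AnalyticMetric n M) (φ : OpenPartialHomeomorph M (Model n)) (u : Model n) :
    Matrix (Fin n) (Fin n) ℝ :=
  Matrix.of fun i j => comp φ g.field u ![i, j]

/-- The components `g^{ij}` of the inverse metric in the chart `φ`. -/
def gUp (g : AnalyticMetric n M) (φ : OpenPartialHomeomorph M (Model n)) (u : Model n) :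
    Matrix (Fin n) (Fin n) ℝ :=
  (gLow g φ u)⁻¹

/-- The Christoffel symbols `Γᵐ_{ij}` of the Levi-Civita connection in the chart `φ`. -/
def christoffel (g : AnalyticMetric n M) (φ : OpenPartialHomeomorph M (Model n)) (u : Model n)
    (m i j : Fin n) : ℝ :=
  (1 / 2) * ∑ l, gUp g φ u m l *
    (pd i (fun w => gLow g φ w j l) u + pd j (fun w => gLow g φ w i l) u
      - pd l (fun w => gLow g φ w i j) u)

/-- The components `T_{i₁…iₖ;j} = ∂ⱼ T_{i₁…iₖ} - ∑ₛ Γᵐ_{j iₛ} T_{i₁…m…iₖ}` (with `m` in the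
`s`-th place) of the Levi-Civita covariant derivative of `T`, in the chart `φ`. -/
def covD (g : AnalyticMetric n M) (φ : OpenPartialHomeomorph M (Model n))
    (T : TensorField n k M) (u : Model n) (I : Fin k → Fin n) (j : Fin n) : ℝ :=
  pd j (fun w => comp φ T w I) u
    - ∑ s : Fin k, ∑ m : Fin n,
        christoffel g φ u m j (I s) * comp φ T u (Function.update I s m)

end Connection

section Potentials

variable {n : ℕ} {M : Type*} [TopologicalSpace M] [ChartedSpace (Model n) M]

/-- A Ricci candidate: a symmetric 2-tensor field. -/
def IsRicciCandidate (R : TensorField n 2 M) : Prop :=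
  ∀ (x : M) (a b : TangentSpace (𝓡 n) x), R x ![a, b] = R x ![b, a]

/-- A Riemann candidate: `R_{abcd} = R_{[ab][cd]}` and `R_{a[bcd]} = 0`. -/
structure IsRiemannCandidate (R : TensorField n 4 M) : Prop where
  antisymm_left : ∀ (x : M) (a b c d : TangentSpace (𝓡 n) x),
    R x ![a, b, c, d] = -R x ![b, a, c, d]
  antisymm_right : ∀ (x : M) (a b c d : TangentSpace (𝓡 n) x),
    R x ![a, b, c, d] = -R x ![a, b, d, c]
  bianchi : ∀ (x : M) (a : TangentSpace (𝓡 n) x) (v : Fin 3 → TangentSpace (𝓡 n) x),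
    ∑ σ : Equiv.Perm (Fin 3), ((Equiv.Perm.sign σ : ℤ) : ℝ) *
      R x ![a, v (σ 0), v (σ 1), v (σ 2)] = 0

/-- `(Y, Z)` is a pair of potentials for the 2-tensor field `R` on the open subset `U` of the
domain of the chart `φ`: `Y` is an analytic double (1,2)-form with `Y_{[abc]} = 0`, `Z` is an
analytic 1-form, and `R_{ab} = ½ (Y_{abe}^{;e} + Y_{bae}^{;e} + Z_{a;b} + Z_{b;a})` on `U`. -/
structure IsRicciPotential (g : AnalyticMetric n M) (φ : OpenPartialHomeomorph M (Model n))
    (U : Set M) (R : TensorField n 2 M) (Y : TensorField n 3 M) (Z : TensorField n 1 M) :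
    Prop where
  analytic_Y : AnalyticInChart φ U Y
  analytic_Z : AnalyticInChart φ U Z
  double_form : ∀ x ∈ U, ∀ a b c : TangentSpace (𝓡 n) x, Y x ![a, b, c] = -Y x ![a, c, b]
  alt_eq_zero : ∀ x ∈ U, ∀ v : Fin 3 → TangentSpace (𝓡 n) x,
    ∑ σ : Equiv.Perm (Fin 3), ((Equiv.Perm.sign σ : ℤ) : ℝ) *
      Y x ![v (σ 0), v (σ 1), v (σ 2)] = 0
  eq : ∀ x ∈ U, ∀ a b : Fin n,
    comp φ R (φ x) ![a, b] = (1 / 2) *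
      ((∑ e, ∑ f, gUp g φ (φ x) e f * covD g φ Y (φ x) ![a, b, e] f)
        + (∑ e, ∑ f, gUp g φ (φ x) e f * covD g φ Y (φ x) ![b, a, e] f)
        + covD g φ Z (φ x) ![a] b + covD g φ Z (φ x) ![b] a)

/-- `(Y, Z)` is a pair of potentials for the Riemann candidate `R` on the open subset `U` of the
domain of the chart `φ`: `Y` is an analytic double (2,3)-form with `Y_{a[bcde]} = 0`, `Z` is an
analytic double (2,1)-form with `Z_{[abc]} = 0`, and
`R_{abcd} = ½ (Y_{abcde}^{;e} + Y_{cdabe}^{;e} + 2 Z_{ab[c;d]} + 2 Z_{cd[a;b]})` on `U`. -/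
structure IsRiemannPotential (g : AnalyticMetric n M) (φ : OpenPartialHomeomorph M (Model n))
    (U : Set M) (R : TensorField n 4 M) (Y : TensorField n 5 M) (Z : TensorField n 3 M) :
    Prop where
  analytic_Y : AnalyticInChart φ U Y
  analytic_Z : AnalyticInChart φ U Z
  double_form_Y_ab : ∀ x ∈ U, ∀ a b c d e : TangentSpace (𝓡 n) x,
    Y x ![a, b, c, d, e] = -Y x ![b, a, c, d, e]
  double_form_Y_cd : ∀ x ∈ U, ∀ a b c d e : TangentSpace (𝓡 n) x,
    Y x ![a, b, c, d, e] = -Y x ![a, b, d, c, e]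
  double_form_Y_de : ∀ x ∈ U, ∀ a b c d e : TangentSpace (𝓡 n) x,
    Y x ![a, b, c, d, e] = -Y x ![a, b, c, e, d]
  double_form_Z : ∀ x ∈ U, ∀ a b c : TangentSpace (𝓡 n) x, Z x ![a, b, c] = -Z x ![b, a, c]
  alt_Y_eq_zero : ∀ x ∈ U, ∀ (a : TangentSpace (𝓡 n) x) (v : Fin 4 → TangentSpace (𝓡 n) x),
    ∑ σ : Equiv.Perm (Fin 4), ((Equiv.Perm.sign σ : ℤ) : ℝ) *
      Y x ![a, v (σ 0), v (σ 1), v (σ 2), v (σ 3)] = 0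
  alt_Z_eq_zero : ∀ x ∈ U, ∀ v : Fin 3 → TangentSpace (𝓡 n) x,
    ∑ σ : Equiv.Perm (Fin 3), ((Equiv.Perm.sign σ : ℤ) : ℝ) *
      Z x ![v (σ 0), v (σ 1), v (σ 2)] = 0
  eq : ∀ x ∈ U, ∀ a b c d : Fin n,
    comp φ R (φ x) ![a, b, c, d] = (1 / 2) *
      ((∑ e, ∑ f, gUp g φ (φ x) e f * covD g φ Y (φ x) ![a, b, c, d, e] f)
        + (∑ e, ∑ f, gUp g φ (φ x) e f * covD g φ Y (φ x) ![c, d, a, b, e] f)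
        + (covD g φ Z (φ x) ![a, b, c] d - covD g φ Z (φ x) ![a, b, d] c)
        + (covD g φ Z (φ x) ![c, d, a] b - covD g φ Z (φ x) ![c, d, b] a))

/-- `S` is the Ricci trace of `R` on `U`: `S_{ab} = R^c_{acb}`. -/
def IsRicciTrace (g : AnalyticMetric n M) (φ : OpenPartialHomeomorph M (Model n))
    (U : Set M) (R : TensorField n 4 M) (S : TensorField n 2 M) : Prop :=
  ∀ x ∈ U, ∀ a b : Fin n,
    comp φ S (φ x) ![a, b] =
      ∑ e, ∑ f, gUp g φ (φ x) e f * comp φ R (φ x) ![e, a, f, b]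

/-- `(Y, Z)` arise from `(Y', Z')` by traces on `U`:
`Y_{cab} = Y'^e_{ceab} + Z'_{abc}` and `Z_a = Z'_{ea}^e`. -/
def IsPotentialTrace (g : AnalyticMetric n M) (φ : OpenPartialHomeomorph M (Model n))
    (U : Set M) (Y' : TensorField n 5 M) (Z' : TensorField n 3 M)
    (Y : TensorField n 3 M) (Z : TensorField n 1 M) : Prop :=
  (∀ x ∈ U, ∀ c a b : Fin n,
    comp φ Y (φ x) ![c, a, b] =
      (∑ e, ∑ f, gUp g φ (φ x) e f * comp φ Y' (φ x) ![e, c, f, a, b])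
        + comp φ Z' (φ x) ![a, b, c]) ∧
  (∀ x ∈ U, ∀ a : Fin n,
    comp φ Z (φ x) ![a] =
      ∑ e, ∑ f, gUp g φ (φ x) e f * comp φ Z' (φ x) ![e, a, f])

end Potentials

end

/-! ### Coordinate frames of a chart and components of tensor fields -/

noncomputable section

open Module

section Geometry

variable {n k : ℕ} {M : Type*} [TopologicalSpace M] [ChartedSpace (Model n) M]

section Chart

variable {φ : OpenPartialHomeomorph M (Model n)}

/-! Existence of potentials is reduced to one determined system by an ansatz. In a chart, take a
symmetric array `σ_{ab}` and put `Y_{abe} = ∂ₑσ_{ab} - ∂_bσ_{ae}`, `Z_a = g^{ef}∂_fσ_{ae}`. The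
symmetries of `Y` are then automatic. In `Y_{abe}^{;e} + Z_{a;b}` the term `-g^{ef}∂_f∂_bσ_{ae}`
from `Y` cancels the second-order term from `Z`; what remains is `g^{ef}∂ₑ∂_fσ_{ab}` plus terms
linear in the first derivatives of `σ`. Symmetrizing in `a, b` turns (*) into a linear analytic
system for `σ` whose principal part is the same scalar operator `g^{ef}∂ₑ∂_f` in every equation
(`exists_symmetric_solution`, `exists_isRicciPotential`).

Such a system is solved by a Cauchy-Kovalevskaya argument that needs no change of coordinates
(`exists_formal_solution`, `exists_analytic_solution`). Since `g^{ef}` is not zero at the point,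
there are `i, j` with `g^{ij} ≠ 0`; one takes `i = j` if some diagonal entry is nonzero, and
otherwise all diagonal entries vanish. The unknown becomes `v = ∂_i∂_jσ`, with `σ` the iterated
integral of `v` that vanishes on the coordinate hyperplanes: a Cauchy problem if `i = j`, a Goursat
problem if not. With the frozen coefficient of `∂_i∂_j` isolated, the equation reads `v = f + K v`.
On Taylor coefficients with the `ℓ¹` weights `ρ^α / |α|!`, multiplication is submultiplicative
(`wnorm_leibniz_le`), and `∂^δ∂^{-η}` has norm at most `ρ^η / ρ^δ` when `|δ| ≤ |η|`
(`wnorm_shift_le`). Giving the directions `i, j` the weight `r²` and all others `r` makes `K` of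
size `O(r)`, so a Neumann series converges. Comparison with the weights `r^|α| / α!` converts
between these norms and convergent power series.

The trace statement is an identity. Covariant differentiation commutes with contraction by `g^{ef}`,
by metric compatibility (`pd_gUp`, `covD_trace_one`, `covD_trace_three`), so the Riemann potential
equation can be traced term by term. The terms `Z_{ab[c;d]}` contribute both `Z_{a;b}` and
divergences of `Z`; the latter are exactly the summand `Z_{ab}{}^c` in the definition of the traced
`Y`. The identity `Y_{[abc]} = 0` follows from `Y_{a[bcde]} = 0`, because the leftover term is
antisymmetric in the pair contracted with the symmetric `g^{ef}`. -/

theorem TensorField.apply_congr (T : TensorField n k M) {x y : M} (h : y = x)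
    (v : Fin k → Model n) : T y v = T x v := by
  subst h; rfl

theorem mdifferentiable_of_mem_maximalAtlas (hφ : φ ∈ IsManifold.maximalAtlas (𝓡 n) ω M) :
    φ.MDifferentiable (𝓡 n) (𝓡 n) :=
  ⟨(contMDiffOn_of_mem_maximalAtlas hφ).mdifferentiableOn (by simp),
    (contMDiffOn_symm_of_mem_maximalAtlas hφ).mdifferentiableOn (by simp)⟩

/-- The basis of the tangent space given by the coordinate vector fields of a chart. -/
def coordBasis (hφ : φ ∈ IsManifold.maximalAtlas (𝓡 n) ω M) {x : M} (hx : x ∈ φ.source) :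
    Basis (Fin n) ℝ (TangentSpace (𝓡 n) x) :=
  Basis.map ((EuclideanSpace.basisFun (Fin n) ℝ).toBasis : Basis (Fin n) ℝ (Model n))
    (((mdifferentiable_of_mem_maximalAtlas hφ).mfderiv hx).symm.toLinearEquiv :
      Model n ≃ₗ[ℝ] TangentSpace (𝓡 n) x)

theorem coordBasis_apply (hφ : φ ∈ IsManifold.maximalAtlas (𝓡 n) ω M) {x : M}
    (hx : x ∈ φ.source) (i : Fin n) :
    coordBasis hφ hx i = coordVec φ (φ x) i := by
  refine (Basis.map_apply _ _ _).trans ?_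
  rw [OrthonormalBasis.coe_toBasis, EuclideanSpace.basisFun_apply]
  rfl

/-- `comp` evaluates at `φ.symm (φ x)`, which equals `x` only propositionally; this moves the
evaluation to `x` itself, where the pointwise symmetries are stated. -/
theorem comp_eq_coordBasis (hφ : φ ∈ IsManifold.maximalAtlas (𝓡 n) ω M) {x : M}
    (hx : x ∈ φ.source) (T : TensorField n k M) (I : Fin k → Fin n) :
    comp φ T (φ x) I = T x (fun s => coordBasis hφ hx (I s)) := by
  simp only [coordBasis_apply]
  exact TensorField.apply_congr T (φ.left_inv hx) _

/-- The coordinate covectors `dxⁱ` of a chart. -/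
def coordCovec (φ : OpenPartialHomeomorph M (Model n)) (x : M) (i : Fin n) :
    TangentSpace (𝓡 n) x →ₗ[ℝ] ℝ where
  toFun v := EuclideanSpace.proj (𝕜 := ℝ) i (show Model n from mfderiv (𝓡 n) (𝓡 n) φ x v)
  map_add' v w := by rw [map_add]; rfl
  map_smul' c v := by rw [map_smul]; rfl

/-- The tensor field with prescribed components in a chart. -/
def ofComp (φ : OpenPartialHomeomorph M (Model n)) (c : Model n → (Fin k → Fin n) → ℝ) :
    TensorField n k M := fun x =>
  ∑ I : Fin k → Fin n, c (φ x) I •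
    (MultilinearMap.mkPiAlgebra ℝ (Fin k) ℝ).compLinearMap (fun s => coordCovec φ x (I s))

theorem mfderiv_coordBasis (hφ : φ ∈ IsManifold.maximalAtlas (𝓡 n) ω M) {x : M}
    (hx : x ∈ φ.source) (i : Fin n) :
    mfderiv (𝓡 n) (𝓡 n) φ x (coordBasis hφ hx i) = EuclideanSpace.single i (1 : ℝ) := by
  rw [coordBasis_apply]
  exact ((mdifferentiable_of_mem_maximalAtlas hφ).mfderiv hx).apply_symm_apply
    (EuclideanSpace.single i (1 : ℝ))

theorem coordCovec_coordBasis (hφ : φ ∈ IsManifold.maximalAtlas (𝓡 n) ω M) {x : M}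
    (hx : x ∈ φ.source) (i j : Fin n) :
    coordCovec φ x i (coordBasis hφ hx j) = if i = j then 1 else 0 := by
  change EuclideanSpace.proj (𝕜 := ℝ) i
    (show Model n from mfderiv (𝓡 n) (𝓡 n) φ x (coordBasis hφ hx j)) = _
  rw [mfderiv_coordBasis]
  simp

theorem comp_ofComp (hφ : φ ∈ IsManifold.maximalAtlas (𝓡 n) ω M)
    (c : Model n → (Fin k → Fin n) → ℝ) {u : Model n} (hu : u ∈ φ.target) (I : Fin k → Fin n) :
    comp φ (ofComp φ c) u I = c u I := by
  obtain ⟨x, hx, rfl⟩ : ∃ x ∈ φ.source, φ x = u :=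
    ⟨φ.symm u, φ.map_target hu, φ.right_inv hu⟩
  rw [comp_eq_coordBasis hφ hx, ofComp, _root_.sum_apply, Finset.sum_eq_single I]
  · simp [coordCovec_coordBasis]
  · intro J _ hJ
    obtain ⟨s, hs⟩ := Function.ne_iff.1 hJ
    simp only [_root_.smul_apply, MultilinearMap.compLinearMap_apply,
      MultilinearMap.mkPiAlgebra_apply, smul_eq_mul]
    rw [Finset.prod_eq_zero (Finset.mem_univ s) (by simp [coordCovec_coordBasis, hs]), mul_zero]
  · simp

theorem multilinear_eq_zero_of_coordBasis (hφ : φ ∈ IsManifold.maximalAtlas (𝓡 n) ω M) {x : M}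
    (hx : x ∈ φ.source) (f : MultilinearMap ℝ (fun _ : Fin k => TangentSpace (𝓡 n) x) ℝ)
    (h : ∀ I : Fin k → Fin n, f (fun s => coordBasis hφ hx (I s)) = 0)
    (v : Fin k → TangentSpace (𝓡 n) x) : f v = 0 := by
  have : f = 0 := Basis.ext_multilinear (fun _ => coordBasis hφ hx) (by simpa using h)
  simp [this]

/-- A linear relation between permuted values of a tensor can be checked on components. -/
theorem sum_perm_eq_zero_of_comp (hφ : φ ∈ IsManifold.maximalAtlas (𝓡 n) ω M) {x : M}
    (hx : x ∈ φ.source) (T : TensorField n k M) (c : Equiv.Perm (Fin k) → ℝ)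
    (h : ∀ I : Fin k → Fin n, ∑ σ, c σ * comp φ T (φ x) (I ∘ σ) = 0)
    (v : Fin k → TangentSpace (𝓡 n) x) : ∑ σ, c σ * T x (v ∘ σ) = 0 := by
  have := multilinear_eq_zero_of_coordBasis hφ hx
    (∑ σ, c σ • (T x).domDomCongr σ) (fun I => by
      rw [← h I]
      simp only [comp_eq_coordBasis hφ hx]
      simp) v
  rw [← this]
  simp [Function.comp_def]

end Chart

end Geometry
end

/-! ### Calculus of partial derivatives and analyticity of the inverse matrix -/

noncomputable section

open Module Filter Topology

section PartialDerivative

variable {n : ℕ} {u : Model n} {f f' : Model n → ℝ}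

theorem pd_congr (j : Fin n) (h : f =ᶠ[𝓝 u] f') : pd j f u = pd j f' u := by
  simp only [pd, h.fderiv_eq]

theorem pd_add (j : Fin n) (hf : DifferentiableAt ℝ f u) (hf' : DifferentiableAt ℝ f' u) :
    pd j (fun w => f w + f' w) u = pd j f u + pd j f' u := by
  simp [pd, fderiv_fun_add hf hf']

theorem pd_sub (j : Fin n) (hf : DifferentiableAt ℝ f u) (hf' : DifferentiableAt ℝ f' u) :
    pd j (fun w => f w - f' w) u = pd j f u - pd j f' u := by
  simp [pd, fderiv_fun_sub hf hf']

theorem pd_neg (j : Fin n) : pd j (fun w => -f w) u = -pd j f u := by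
  simp [pd, fderiv_fun_neg]

theorem pd_const (j : Fin n) (c : ℝ) : pd j (fun _ => c) u = 0 := by
  simp [pd]

theorem pd_mul (j : Fin n) (hf : DifferentiableAt ℝ f u) (hf' : DifferentiableAt ℝ f' u) :
    pd j (fun w => f w * f' w) u = pd j f u * f' u + f u * pd j f' u := by
  simp [pd, fderiv_fun_mul hf hf']; ring

theorem pd_sum {ι : Type*} (s : Finset ι) (j : Fin n) {F : ι → Model n → ℝ}
    (hF : ∀ i ∈ s, DifferentiableAt ℝ (F i) u) :
    pd j (fun w => ∑ i ∈ s, F i w) u = ∑ i ∈ s, pd j (F i) u := by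
  simp [pd, fderiv_fun_sum hF]

theorem AnalyticAt.pd (hf : AnalyticAt ℝ f u) (j : Fin n) : AnalyticAt ℝ (pd j f) u := by
  have := ((ContinuousLinearMap.apply ℝ ℝ
    (EuclideanSpace.single j (1 : ℝ) : Model n)).analyticAt (fderiv ℝ f u)).comp hf.fderiv
  exact this

theorem pd_comm (hf : AnalyticAt ℝ f u) (i j : Fin n) :
    pd i (pd j f) u = pd j (pd i f) u := by
  have h : ∀ i j : Fin n, pd i (pd j f) u = fderiv ℝ (fderiv ℝ f) u
      (EuclideanSpace.single i (1 : ℝ)) (EuclideanSpace.single j (1 : ℝ)) := by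
    intro i j
    have := fderiv_clm_apply (𝕜 := ℝ) (c := fderiv ℝ f)
      (u := fun _ : Model n => (EuclideanSpace.single j (1 : ℝ) : Model n)) (x := u)
      hf.fderiv.differentiableAt (differentiableAt_const _)
    change fderiv ℝ (fun y => fderiv ℝ f y (EuclideanSpace.single j (1 : ℝ))) u _ = _
    rw [this]
    simp
  rw [h, h]
  exact (hf.contDiffAt (n := ω)).isSymmSndFDerivAt (by simp) _ _

end PartialDerivative

section MatrixAnalytic

variable {ι E : Type*} [Fintype ι] [DecidableEq ι] [NormedAddCommGroup E] [NormedSpace ℝ E]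
  {A : E → Matrix ι ι ℝ} {x : E}

theorem analyticAt_matrix_det (hA : ∀ i j, AnalyticAt ℝ (fun y => A y i j) x) :
    AnalyticAt ℝ (fun y => (A y).det) x := by
  simp only [Matrix.det_apply']
  exact Finset.analyticAt_fun_sum _ fun σ _ => analyticAt_const.mul
    (Finset.analyticAt_fun_prod _ fun i _ => hA _ _)

theorem analyticAt_matrix_inv (hA : ∀ i j, AnalyticAt ℝ (fun y => A y i j) x)
    (h0 : (A x).det ≠ 0) (i j : ι) : AnalyticAt ℝ (fun y => (A y)⁻¹ i j) x := by
  simp only [Matrix.inv_def, Matrix.smul_apply, Ring.inverse_eq_inv', smul_eq_mul,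
    Matrix.adjugate_apply]
  refine ((analyticAt_matrix_det hA).inv h0).mul (analyticAt_matrix_det fun k l => ?_)
  rcases eq_or_ne k j with rfl | hk
  · simpa using! analyticAt_const
  · simpa [Matrix.updateRow_ne hk] using! hA k l

end MatrixAnalytic

/-! ### Metric, Christoffel symbols and metric compatibility -/

section Metric

variable {n k : ℕ} {M : Type*} [TopologicalSpace M] [ChartedSpace (Model n) M]
  {φ : OpenPartialHomeomorph M (Model n)} (hφ : φ ∈ IsManifold.maximalAtlas (𝓡 n) ω M)
  (g : AnalyticMetric n M) {x : M} (hx : x ∈ φ.source)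

include hφ hx

theorem gLow_eq_coordBasis (i j : Fin n) :
    gLow g φ (φ x) i j = g.field x ![coordBasis hφ hx i, coordBasis hφ hx j] := by
  simp only [gLow, Matrix.of_apply, comp_eq_coordBasis hφ hx]
  congr 1
  funext s
  fin_cases s <;> rfl

theorem gLow_comm (i j : Fin n) : gLow g φ (φ x) i j = gLow g φ (φ x) j i := by
  simp only [gLow_eq_coordBasis hφ g hx]
  exact g.symm _ _ _

/-- A vector in the kernel of the Gram matrix gives a combination of coordinate vectors orthogonal
to the whole tangent space, hence zero by nondegeneracy. -/
theorem gLow_det_ne_zero : (gLow g φ (φ x)).det ≠ 0 := by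
  intro h
  obtain ⟨c, hc, hc0⟩ := Matrix.exists_vecMul_eq_zero_iff.2 h
  set b := coordBasis hφ hx
  have hzero : (∑ i, c i • b i) = 0 := by
    apply g.nondegenerate x
    intro w
    let B : TangentSpace (𝓡 n) x →ₗ[ℝ] TangentSpace (𝓡 n) x →ₗ[ℝ] ℝ :=
      LinearMap.mk₂ ℝ (fun v w => g.field x ![v, w])
        (fun v v' w => by simpa using (g.field x).cons_add ![w] v v')
        (fun a v w => by simpa using (g.field x).cons_smul ![w] a v)
        (fun v w w' => by
          rw [g.symm x v, g.symm x v, g.symm x v]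
          simpa using (g.field x).cons_add ![v] w w')
        (fun a v w => by
          rw [g.symm x v, g.symm x v]
          simpa using (g.field x).cons_smul ![v] a w)
    have hB : B (∑ i, c i • b i) = 0 := by
      refine b.ext fun j => ?_
      have := congrFun hc0 j
      simp only [Matrix.vecMul, dotProduct, gLow_eq_coordBasis hφ g hx] at this
      simpa [B] using this
    exact DFunLike.congr_fun hB w
  apply hc
  funext i
  have := congrArg (fun v => b.repr v i) hzero
  simpa [Finsupp.single_apply] using this

theorem gUp_mul_gLow : gUp g φ (φ x) * gLow g φ (φ x) = 1 :=
  Matrix.nonsing_inv_mul _ (isUnit_iff_ne_zero.2 (gLow_det_ne_zero hφ g hx))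

theorem gUp_comm (i j : Fin n) : gUp g φ (φ x) i j = gUp g φ (φ x) j i := by
  have : (gUp g φ (φ x)).transpose = gUp g φ (φ x) := by
    rw [gUp, Matrix.transpose_nonsing_inv]
    congr 1
    ext i j
    exact gLow_comm hφ g hx j i
  exact congrFun (congrFun this j) i

theorem analyticAt_gLow (i j : Fin n) : AnalyticAt ℝ (fun u => gLow g φ u i j) (φ x) :=
  g.analytic φ hφ ![i, j] x hx

theorem analyticAt_gUp (i j : Fin n) : AnalyticAt ℝ (fun u => gUp g φ u i j) (φ x) :=
  analyticAt_matrix_inv (fun i j => analyticAt_gLow hφ g hx i j) (gLow_det_ne_zero hφ g hx) i j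

theorem analyticAt_christoffel (m i j : Fin n) :
    AnalyticAt ℝ (fun u => christoffel g φ u m i j) (φ x) := by
  unfold christoffel
  refine analyticAt_const.mul (Finset.analyticAt_fun_sum _ fun l _ => ?_)
  exact (analyticAt_gUp hφ g hx m l).mul
    ((((analyticAt_gLow hφ g hx j l).pd i).add ((analyticAt_gLow hφ g hx i l).pd j)).sub
      ((analyticAt_gLow hφ g hx i j).pd l))

omit [ChartedSpace (Model n) M] hφ in
-- Pointwise identities on an open set of the manifold become identities near `φ x` in coordinates,
-- which is what allows them to be differentiated.
theorem eventually_nhds_chart {U : Set M} (hU : IsOpen U) (hxU : x ∈ U)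
    {P : Model n → Prop} (h : ∀ y ∈ U, P (φ y)) : ∀ᶠ u in 𝓝 (φ x), P u := by
  have h1 : ∀ᶠ u in 𝓝 (φ x), u ∈ φ.target := φ.open_target.mem_nhds (φ.map_source hx)
  have h2 : ∀ᶠ u in 𝓝 (φ x), φ.symm u ∈ U := by
    have := φ.continuousAt_symm (φ.map_source hx)
    refine this.eventually_mem ?_
    rw [φ.left_inv hx]
    exact hU.mem_nhds hxU
  filter_upwards [h1, h2] with u hu1 hu2
  simpa [φ.right_inv hu1] using h _ hu2

/-- This is `∇g⁻¹ = 0`. Differentiating `g⁻¹g = 1` gives `∂g⁻¹ = -g⁻¹(∂g)g⁻¹`, and `∂_j g` is half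
the sum of the bracket in the Christoffel symbols and its transpose. -/
theorem pd_gUp (j e f : Fin n) :
    pd j (fun u => gUp g φ u e f) (φ x) =
      -(∑ m, christoffel g φ (φ x) e j m * gUp g φ (φ x) m f)
        - ∑ m, christoffel g φ (φ x) f j m * gUp g φ (φ x) e m := by
  set U := gUp g φ (φ x) with hUdef
  set G := gLow g φ (φ x) with hGdef
  let D : Matrix (Fin n) (Fin n) ℝ := Matrix.of fun a b => pd j (fun u => gLow g φ u a b) (φ x)
  let D' : Matrix (Fin n) (Fin n) ℝ := Matrix.of fun a b => pd j (fun u => gUp g φ u a b) (φ x)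
  let C : Matrix (Fin n) (Fin n) ℝ := Matrix.of fun l m =>
    pd j (fun w => gLow g φ w m l) (φ x) + pd m (fun w => gLow g φ w j l) (φ x)
      - pd l (fun w => gLow g φ w j m) (φ x)
  let Γ : Matrix (Fin n) (Fin n) ℝ := Matrix.of fun a b => christoffel g φ (φ x) a j b
  have hUG : U * G = 1 := gUp_mul_gLow hφ g hx
  have hGU : G * U = 1 := mul_eq_one_comm.1 hUG
  have hUt : U.transpose = U := by ext a b; exact gUp_comm hφ g hx b a
  have hΓ : Γ = (1 / 2 : ℝ) • (U * C) := by
    ext a b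
    simp [Γ, C, christoffel, Matrix.mul_apply, U]
  have hsym : ∀ (i a b : Fin n), pd i (fun w => gLow g φ w a b) (φ x)
      = pd i (fun w => gLow g φ w b a) (φ x) := fun i a b =>
    pd_congr i (eventually_nhds_chart hx φ.open_source hx
      (P := fun u => gLow g φ u a b = gLow g φ u b a) fun y hy => gLow_comm hφ g hy a b)
  have hC : C + C.transpose = (2 : ℝ) • D := by
    ext a b
    simp only [C, D, Matrix.add_apply, Matrix.transpose_apply, Matrix.of_apply, Matrix.smul_apply,
      smul_eq_mul]
    rw [hsym j b a]; ring
  have hD : D' * G + U * D = 0 := by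
    ext a c
    have h1 : pd j (fun u => ∑ b, gUp g φ u a b * gLow g φ u b c) (φ x) = 0 := by
      rw [← pd_const (u := φ x) j ((1 : Matrix (Fin n) (Fin n) ℝ) a c)]
      refine pd_congr j (eventually_nhds_chart hx φ.open_source hx
        (P := fun u => (∑ b, gUp g φ u a b * gLow g φ u b c) = (1 : Matrix (Fin n) (Fin n) ℝ) a c)
        fun y hy => ?_)
      rw [← gUp_mul_gLow hφ g hy, Matrix.mul_apply]
    rw [pd_sum _ _ (fun b _ => ((analyticAt_gUp hφ g hx a b).fun_mul
      (analyticAt_gLow hφ g hx b c)).differentiableAt)] at h1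
    simp only [Matrix.add_apply, Matrix.mul_apply, Matrix.zero_apply, ← Finset.sum_add_distrib]
    rw [← h1]
    refine Finset.sum_congr rfl fun b _ => ?_
    rw [pd_mul _ (analyticAt_gUp hφ g hx a b).differentiableAt
      (analyticAt_gLow hφ g hx b c).differentiableAt]
    rfl
  have hD' : D' = -(U * D * U) := by
    have : D' * G * U = -(U * D) * U := by rw [eq_neg_of_add_eq_zero_left hD]
    rwa [Matrix.mul_assoc, hGU, Matrix.mul_one, Matrix.neg_mul] at this
  have hfin : D' = -(Γ * U) - (Γ * U).transpose := by
    rw [hD', Matrix.transpose_mul, hUt, hΓ, Matrix.transpose_smul, Matrix.transpose_mul, hUt]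
    have : D = (1 / 2 : ℝ) • (C + C.transpose) := by rw [hC, smul_smul]; norm_num
    rw [this]
    simp only [Matrix.mul_smul, Matrix.smul_mul, Matrix.mul_add, Matrix.add_mul, smul_add,
      Matrix.mul_assoc]
    abel
  have := congrFun (congrFun hfin e) f
  simp only [D', Matrix.of_apply, Matrix.sub_apply, Matrix.neg_apply, Matrix.mul_apply,
    Matrix.transpose_apply, Γ] at this
  rw [this]
  congr 1
  refine Finset.sum_congr rfl fun m _ => ?_
  rw [hUdef, gUp_comm hφ g hx m e]

omit hφ hx in
theorem sum_comm_outer_inner {ι R : Type*} [Fintype ι] [AddCommMonoid R] (F : ι → ι → ι → R) :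
    ∑ e, ∑ f, ∑ m, F e f m = ∑ e, ∑ f, ∑ m, F m f e := by
  rw [Finset.sum_comm]
  conv_rhs => rw [Finset.sum_comm]
  exact Finset.sum_congr rfl fun f _ => Finset.sum_comm

/-- Metric compatibility, contracted with an arbitrary array. -/
theorem sum_pd_gUp_mul (j : Fin n) (W : Fin n → Fin n → ℝ) :
    ∑ e, ∑ f, pd j (fun u => gUp g φ u e f) (φ x) * W e f =
      -∑ e, ∑ f, gUp g φ (φ x) e f * ((∑ m, christoffel g φ (φ x) m j e * W m f)
        + ∑ m, christoffel g φ (φ x) m j f * W e m) := by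
  simp only [pd_gUp hφ g hx, sub_mul, neg_mul, mul_add, Finset.sum_add_distrib,
    Finset.sum_sub_distrib, Finset.sum_neg_distrib, Finset.mul_sum, Finset.sum_mul]
  rw [neg_add, sub_eq_add_neg]
  congr 2
  · rw [sum_comm_outer_inner]
    exact Finset.sum_congr rfl fun e _ => Finset.sum_congr rfl fun f _ =>
      Finset.sum_congr rfl fun m _ => by ring
  · refine Finset.sum_congr rfl fun e _ => ?_
    rw [Finset.sum_comm]
    exact Finset.sum_congr rfl fun f _ => Finset.sum_congr rfl fun m _ => by ring

end Metric

/-! ### Covariant derivatives commute with metric contractions -/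

section Trace

variable {n k : ℕ} {M : Type*} [TopologicalSpace M] [ChartedSpace (Model n) M]
  {φ : OpenPartialHomeomorph M (Model n)} {g : AnalyticMetric n M} {x : M}

theorem covD_one (T : TensorField n 1 M) (u : Model n) (a j : Fin n) :
    covD g φ T u ![a] j = pd j (fun w => comp φ T w ![a]) u
      - ∑ m, christoffel g φ u m j a * comp φ T u ![m] := by
  have : ∀ m, Function.update ![a] 0 m = ![m] := by
    intro m; ext i; fin_cases i; simp
  simp [covD, this]

theorem covD_three (T : TensorField n 3 M) (u : Model n) (a b c j : Fin n) :
    covD g φ T u ![a, b, c] j = pd j (fun w => comp φ T w ![a, b, c]) u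
      - ((∑ m, christoffel g φ u m j a * comp φ T u ![m, b, c])
        + (∑ m, christoffel g φ u m j b * comp φ T u ![a, m, c])
        + ∑ m, christoffel g φ u m j c * comp φ T u ![a, b, m]) := by
  have h0 : ∀ m, Function.update ![a, b, c] 0 m = ![m, b, c] := by
    intro m; ext i; fin_cases i <;> simp
  have h1 : ∀ m, Function.update ![a, b, c] 1 m = ![a, m, c] := by
    intro m; ext i; fin_cases i <;> simp
  have h2 : ∀ m, Function.update ![a, b, c] 2 m = ![a, b, m] := by
    intro m; ext i; fin_cases i <;> simp
  simp [covD, Fin.sum_univ_three, h0, h1, h2]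

theorem covD_five (T : TensorField n 5 M) (u : Model n) (a b c d e j : Fin n) :
    covD g φ T u ![a, b, c, d, e] j = pd j (fun w => comp φ T w ![a, b, c, d, e]) u
      - ((∑ m, christoffel g φ u m j a * comp φ T u ![m, b, c, d, e])
        + (∑ m, christoffel g φ u m j b * comp φ T u ![a, m, c, d, e])
        + (∑ m, christoffel g φ u m j c * comp φ T u ![a, b, m, d, e])
        + (∑ m, christoffel g φ u m j d * comp φ T u ![a, b, c, m, e])
        + ∑ m, christoffel g φ u m j e * comp φ T u ![a, b, c, d, m]) := by
  have h0 : ∀ m, Function.update ![a, b, c, d, e] 0 m = ![m, b, c, d, e] := by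
    intro m; ext i; fin_cases i <;> simp
  have h1 : ∀ m, Function.update ![a, b, c, d, e] 1 m = ![a, m, c, d, e] := by
    intro m; ext i; fin_cases i <;> simp
  have h2 : ∀ m, Function.update ![a, b, c, d, e] 2 m = ![a, b, m, d, e] := by
    intro m; ext i; fin_cases i <;> simp
  have h3 : ∀ m, Function.update ![a, b, c, d, e] 3 m = ![a, b, c, m, e] := by
    intro m; ext i; fin_cases i <;> simp
  have h4 : ∀ m, Function.update ![a, b, c, d, e] 4 m = ![a, b, c, d, m] := by
    intro m; ext i; fin_cases i <;> simp
  simp [covD, Fin.sum_univ_five, h0, h1, h2, h3, h4]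

variable (hφ : φ ∈ IsManifold.maximalAtlas (𝓡 n) ω M) (hx : x ∈ φ.source)
include hφ hx

/-- By the product rule the derivative falls on `g^{ef}` or on `Z'`; the former supplies, via
`sum_pd_gUp_mul`, precisely the connection terms of the two contracted slots, which `Z` itself
lacks. -/
theorem covD_trace_one {U : Set M} (hU : IsOpen U) (hxU : x ∈ U)
    {Z' : TensorField n 3 M} {Z : TensorField n 1 M} (hZ' : AnalyticInChart φ U Z')
    (hZ : ∀ y ∈ U, ∀ a : Fin n, comp φ Z (φ y) ![a] =
      ∑ e, ∑ f, gUp g φ (φ y) e f * comp φ Z' (φ y) ![e, a, f]) (a j : Fin n) :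
    covD g φ Z (φ x) ![a] j =
      ∑ e, ∑ f, gUp g φ (φ x) e f * covD g φ Z' (φ x) ![e, a, f] j := by
  have hev := eventually_nhds_chart hx hU hxU (P := fun u => comp φ Z u ![a] =
    ∑ e, ∑ f, gUp g φ u e f * comp φ Z' u ![e, a, f]) (fun y hy => hZ y hy a)
  have hd : ∀ e f, DifferentiableAt ℝ (fun u => gUp g φ u e f) (φ x) := fun e f =>
    (analyticAt_gUp hφ g hx e f).differentiableAt
  have hd' : ∀ I, DifferentiableAt ℝ (fun u => comp φ Z' u I) (φ x) := fun I =>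
    (hZ' I x hxU).differentiableAt
  have hpd : pd j (fun w => comp φ Z w ![a]) (φ x) =
      ∑ e, ∑ f, (pd j (fun u => gUp g φ u e f) (φ x) * comp φ Z' (φ x) ![e, a, f]
        + gUp g φ (φ x) e f * pd j (fun u => comp φ Z' u ![e, a, f]) (φ x)) := by
    rw [pd_congr j hev, pd_sum _ _ (fun e _ => by fun_prop)]
    refine Finset.sum_congr rfl fun e _ => ?_
    rw [pd_sum _ _ (fun f _ => by fun_prop)]
    exact Finset.sum_congr rfl fun f _ => pd_mul _ (hd e f) (hd' _)
  have hΓ : ∑ m, christoffel g φ (φ x) m j a * comp φ Z (φ x) ![m] =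
      ∑ e, ∑ f, gUp g φ (φ x) e f *
        ∑ m, christoffel g φ (φ x) m j a * comp φ Z' (φ x) ![e, m, f] := by
    simp only [hZ x hxU, Finset.mul_sum]
    rw [Finset.sum_comm]
    refine Finset.sum_congr rfl fun e _ => ?_
    rw [Finset.sum_comm]
    exact Finset.sum_congr rfl fun f _ => Finset.sum_congr rfl fun m _ => by ring
  rw [covD_one, hpd, hΓ]
  simp only [Finset.sum_add_distrib, sum_pd_gUp_mul hφ g hx, covD_three, mul_sub, mul_add,
    Finset.sum_sub_distrib]
  ring

/-- Same mechanism as `covD_trace_one`. The extra summand is a permuted copy of `Z'`, so its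
connection terms are those of `Z'` in another order. -/
theorem covD_trace_three {U : Set M} (hU : IsOpen U) (hxU : x ∈ U)
    {Y' : TensorField n 5 M} {Z' Y : TensorField n 3 M} (hY' : AnalyticInChart φ U Y')
    (hZ' : AnalyticInChart φ U Z')
    (hY : ∀ y ∈ U, ∀ c a b : Fin n, comp φ Y (φ y) ![c, a, b] =
      (∑ e, ∑ f, gUp g φ (φ y) e f * comp φ Y' (φ y) ![e, c, f, a, b])
        + comp φ Z' (φ y) ![a, b, c]) (c a b j : Fin n) :
    covD g φ Y (φ x) ![c, a, b] j =
      (∑ e, ∑ f, gUp g φ (φ x) e f * covD g φ Y' (φ x) ![e, c, f, a, b] j)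
        + covD g φ Z' (φ x) ![a, b, c] j := by
  have hev := eventually_nhds_chart hx hU hxU (P := fun u => comp φ Y u ![c, a, b] =
    (∑ e, ∑ f, gUp g φ u e f * comp φ Y' u ![e, c, f, a, b]) + comp φ Z' u ![a, b, c])
    (fun y hy => hY y hy c a b)
  have hd : ∀ e f, DifferentiableAt ℝ (fun u => gUp g φ u e f) (φ x) := fun e f =>
    (analyticAt_gUp hφ g hx e f).differentiableAt
  have hd' : ∀ I, DifferentiableAt ℝ (fun u => comp φ Y' u I) (φ x) := fun I =>
    (hY' I x hxU).differentiableAt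
  have hd'' : ∀ I, DifferentiableAt ℝ (fun u => comp φ Z' u I) (φ x) := fun I =>
    (hZ' I x hxU).differentiableAt
  have hpd : pd j (fun w => comp φ Y w ![c, a, b]) (φ x) =
      (∑ e, ∑ f, (pd j (fun u => gUp g φ u e f) (φ x) * comp φ Y' (φ x) ![e, c, f, a, b]
        + gUp g φ (φ x) e f * pd j (fun u => comp φ Y' u ![e, c, f, a, b]) (φ x)))
      + pd j (fun u => comp φ Z' u ![a, b, c]) (φ x) := by
    rw [pd_congr j hev, pd_add _ (by fun_prop) (by fun_prop), pd_sum _ _ (fun e _ => by fun_prop)]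
    congr 1
    refine Finset.sum_congr rfl fun e _ => ?_
    rw [pd_sum _ _ (fun f _ => by fun_prop)]
    exact Finset.sum_congr rfl fun f _ => pd_mul _ (hd e f) (hd' _)
  have hswap : ∀ (i : Fin n) (F : Fin n → Fin n → Fin n → ℝ),
      ∑ m, christoffel g φ (φ x) m j i * ∑ e, ∑ f, gUp g φ (φ x) e f * F m e f =
      ∑ e, ∑ f, gUp g φ (φ x) e f * ∑ m, christoffel g φ (φ x) m j i * F m e f := by
    intro i F
    simp only [Finset.mul_sum]
    rw [Finset.sum_comm]
    refine Finset.sum_congr rfl fun e _ => ?_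
    rw [Finset.sum_comm]
    exact Finset.sum_congr rfl fun f _ => Finset.sum_congr rfl fun m _ => by ring
  rw [covD_three, hpd]
  simp only [hY x hxU, mul_add, Finset.sum_add_distrib, hswap, sum_pd_gUp_mul hφ g hx, covD_five,
    mul_sub, Finset.sum_sub_distrib, covD_three]
  ring

omit hφ in
theorem covD_antisymm_three {U : Set M} (hU : IsOpen U) (hxU : x ∈ U) {Z' : TensorField n 3 M}
    (h : ∀ y ∈ U, ∀ a b c : Fin n, comp φ Z' (φ y) ![a, b, c] = -comp φ Z' (φ y) ![b, a, c])
    (a b c j : Fin n) :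
    covD g φ Z' (φ x) ![a, b, c] j = -covD g φ Z' (φ x) ![b, a, c] j := by
  have hev := eventually_nhds_chart hx hU hxU
    (P := fun u => comp φ Z' u ![a, b, c] = -comp φ Z' u ![b, a, c]) (fun y hy => h y hy a b c)
  have h1 : ∀ m, comp φ Z' (φ x) ![m, b, c] = -comp φ Z' (φ x) ![b, m, c] := fun m => h x hxU _ _ _
  have h2 : ∀ m, comp φ Z' (φ x) ![a, m, c] = -comp φ Z' (φ x) ![m, a, c] := fun m => h x hxU _ _ _
  have h3 : ∀ m, comp φ Z' (φ x) ![a, b, m] = -comp φ Z' (φ x) ![b, a, m] := fun m => h x hxU _ _ _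
  rw [covD_three, covD_three, pd_congr j hev, pd_neg]
  simp only [h1, h2, h3, mul_neg, Finset.sum_neg_distrib]
  ring

end Trace

end

/-! ### Alternating sums over small permutation groups -/

noncomputable section

open Module Filter Topology

section Alternation

theorem sum_sign_perm_three (F : Fin 3 → Fin 3 → Fin 3 → ℝ) :
    ∑ σ : Equiv.Perm (Fin 3), ((Equiv.Perm.sign σ : ℤ) : ℝ) * F (σ 0) (σ 1) (σ 2) =
      F 0 1 2 - F 0 2 1 - F 1 0 2 + F 1 2 0 + F 2 0 1 - F 2 1 0 := by
  have : (Finset.univ : Finset (Equiv.Perm (Fin 3))) =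
    {1, Equiv.swap 1 2, Equiv.swap 0 1, Equiv.swap 0 2, Equiv.swap 0 1 * Equiv.swap 1 2,
     Equiv.swap 1 2 * Equiv.swap 0 1} := by decide
  rw [this]
  repeat rw [Finset.sum_insert (by decide)]
  simp [Equiv.swap_apply_def]
  ring
-- Permutations are grouped by the image `i` of `0`; the coset representative is the transposition
-- of `0` and `i`, of sign `-1` unless `i = 0`.
theorem sum_sign_perm_succ {n : ℕ} (F : Equiv.Perm (Fin (n+1)) → ℝ) :
    ∑ σ : Equiv.Perm (Fin (n+1)), ((Equiv.Perm.sign σ : ℤ) : ℝ) * F σ =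
      ∑ i : Fin (n+1), (if i = 0 then 1 else -1) *
        ∑ τ : Equiv.Perm (Fin n), ((Equiv.Perm.sign τ : ℤ) : ℝ) *
          F (Equiv.Perm.decomposeFin.symm (i, τ)) := by
  rw [← Equiv.Perm.decomposeFin.symm.sum_comp, Fintype.sum_prod_type]
  refine Finset.sum_congr rfl fun i _ => ?_
  rw [Finset.mul_sum]
  refine Finset.sum_congr rfl fun τ _ => ?_
  rw [Equiv.Perm.decomposeFin.symm_sign]
  split_ifs <;> push_cast <;> ring

/-- For each image `i` of `0`, antisymmetry makes the six arrangements of the remaining indices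
contribute equally, whence the factor `6 = 3!`. The remaining signs come from sorting those indices.
-/
theorem sum_sign_perm_four (F : Fin 4 → Fin 4 → Fin 4 → Fin 4 → ℝ) 
   (h1 : ∀ a b c d, F a b c d = - F a c b d) (h2 : ∀ a b c d, F a b c d = - F a b d c) :
    ∑ σ : Equiv.Perm (Fin 4), ((Equiv.Perm.sign σ : ℤ) : ℝ) * F (σ 0) (σ 1) (σ 2) (σ 3) =
      6 * (F 0 1 2 3 - F 1 0 2 3 + F 2 0 1 3 - F 3 0 1 2) := by
  rw [sum_sign_perm_succ (fun σ => F (σ 0) (σ 1) (σ 2) (σ 3))]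
  have e1 : (1 : Fin 4) = Fin.succ 0 := rfl
  have e2 : (2 : Fin 4) = Fin.succ 1 := rfl
  have e3 : (3 : Fin 4) = Fin.succ 2 := rfl
  have key : ∀ i : Fin 4, ∑ τ : Equiv.Perm (Fin 3), ((Equiv.Perm.sign τ : ℤ) : ℝ) *
      (fun σ : Equiv.Perm (Fin 4) => F (σ 0) (σ 1) (σ 2) (σ 3)) (Equiv.Perm.decomposeFin.symm (i, τ))
     = 6 * F i (Equiv.swap 0 i 1) (Equiv.swap 0 i 2) (Equiv.swap 0 i 3) := by
    intro i
    simp only [e1, e2, e3, Equiv.Perm.decomposeFin_symm_apply_succ,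
      Equiv.Perm.decomposeFin_symm_apply_zero]
    rw [sum_sign_perm_three (fun a b c => F i (Equiv.swap 0 i a.succ) (Equiv.swap 0 i b.succ) (Equiv.swap 0 i c.succ))]
    generalize Equiv.swap 0 i (Fin.succ 0) = x
    generalize Equiv.swap 0 i (Fin.succ 1) = y
    generalize Equiv.swap 0 i (Fin.succ 2) = z
    linarith [h1 i x y z, h1 i x z y, h1 i y x z, h1 i y z x, h1 i z x y, h1 i z y x, h2 i x y z, h2 i x z y, h2 i y x z, h2 i y z x, h2 i z x y, h2 i z y x]
  simp only [key]
  rw [Fin.sum_univ_four]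
  simp [Equiv.swap_apply_def]
  linarith [h1 2 1 0 3, h2 3 1 2 0, h1 3 1 0 2]

end Alternation

/-! ### Traces of Riemann potentials are Ricci potentials -/

section RicciTrace

variable {n k : ℕ} {M : Type*} [TopologicalSpace M] [ChartedSpace (Model n) M]
  {φ : OpenPartialHomeomorph M (Model n)}

section Components

variable (hφ : φ ∈ IsManifold.maximalAtlas (𝓡 n) ω M) {x : M} (hx : x ∈ φ.source)
include hφ hx

theorem comp_three (T : TensorField n 3 M) (a b c : Fin n) :
    comp φ T (φ x) ![a, b, c] =
      T x ![coordBasis hφ hx a, coordBasis hφ hx b, coordBasis hφ hx c] := by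
  rw [comp_eq_coordBasis hφ hx]
  congr 1
  funext s
  fin_cases s <;> rfl

theorem comp_five (T : TensorField n 5 M) (a b c d e : Fin n) :
    comp φ T (φ x) ![a, b, c, d, e] =
      T x ![coordBasis hφ hx a, coordBasis hφ hx b, coordBasis hφ hx c, coordBasis hφ hx d,
        coordBasis hφ hx e] := by
  rw [comp_eq_coordBasis hφ hx]
  congr 1
  funext s
  fin_cases s <;> rfl

theorem antisymm_of_comp (T : TensorField n 3 M)
    (h : ∀ a b c : Fin n, comp φ T (φ x) ![a, b, c] = -comp φ T (φ x) ![a, c, b])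
    (a b c : TangentSpace (𝓡 n) x) : T x ![a, b, c] = -T x ![a, c, b] := by
  have := multilinear_eq_zero_of_coordBasis hφ hx
    (T x + (T x).domDomCongr (Equiv.swap 1 2)) (fun I => by
      have h0 := h (I 0) (I 1) (I 2)
      simp only [comp_three hφ hx] at h0
      have e1 : (fun s => coordBasis hφ hx (I s)) =
        ![coordBasis hφ hx (I 0), coordBasis hφ hx (I 1), coordBasis hφ hx (I 2)] := by
        funext s; fin_cases s <;> rfl
      have e2 : (fun s => coordBasis hφ hx (I (Equiv.swap 1 2 s))) =
        ![coordBasis hφ hx (I 0), coordBasis hφ hx (I 2), coordBasis hφ hx (I 1)] := by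
        funext s; fin_cases s <;> rfl
      simp only [_root_.add_apply, MultilinearMap.domDomCongr_apply]
      rw [e1, e2, h0]
      ring) ![a, b, c]
  have e2 : (fun s => ![a, b, c] (Equiv.swap 1 2 s)) = ![a, c, b] := by
    funext s; fin_cases s <;> rfl
  simp only [_root_.add_apply, MultilinearMap.domDomCongr_apply, e2] at this
  linarith

/-- Given antisymmetry in the last two slots, the alternating sum is twice the cyclic sum, and both
properties can be tested on a basis. -/
theorem alternation_eq_zero_of_comp (T : TensorField n 3 M)
    (h : ∀ a b c : Fin n, comp φ T (φ x) ![a, b, c] = -comp φ T (φ x) ![a, c, b])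
    (h' : ∀ a b c : Fin n, comp φ T (φ x) ![a, b, c] + comp φ T (φ x) ![b, c, a]
      + comp φ T (φ x) ![c, a, b] = 0)
    (v : Fin 3 → TangentSpace (𝓡 n) x) :
    ∑ σ : Equiv.Perm (Fin 3), ((Equiv.Perm.sign σ : ℤ) : ℝ) *
      T x ![v (σ 0), v (σ 1), v (σ 2)] = 0 := by
  have key := sum_perm_eq_zero_of_comp hφ hx T
    (fun σ => ((Equiv.Perm.sign σ : ℤ) : ℝ)) (fun I => by
      have e : ∀ σ : Equiv.Perm (Fin 3), I ∘ σ = ![I (σ 0), I (σ 1), I (σ 2)] := by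
        intro σ; funext s; fin_cases s <;> rfl
      simp only [e]
      rw [sum_sign_perm_three (fun a b c => comp φ T (φ x) ![I a, I b, I c])]
      linarith [h' (I 0) (I 1) (I 2), h (I 0) (I 2) (I 1), h (I 1) (I 0) (I 2),
        h (I 2) (I 1) (I 0)]) v
  rw [← key]
  refine Finset.sum_congr rfl fun σ _ => ?_
  congr 2
  funext s
  fin_cases s <;> rfl

end Components

section DoubleSum

variable {ι : Type*} [Fintype ι]

theorem double_sum_mul_comm (A B : ι → ι → ℝ) (X : ι → ι → ι → ι → ℝ) :
    ∑ e, ∑ f, A e f * ∑ h, ∑ k, B h k * X e f h k =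
      ∑ h, ∑ k, B h k * ∑ e, ∑ f, A e f * X e f h k := by
  simp only [Finset.mul_sum]
  calc _ = ∑ e, ∑ h, ∑ f, ∑ k, A e f * (B h k * X e f h k) :=
        Finset.sum_congr rfl fun e _ => Finset.sum_comm
    _ = ∑ h, ∑ e, ∑ f, ∑ k, A e f * (B h k * X e f h k) := Finset.sum_comm
    _ = ∑ h, ∑ e, ∑ k, ∑ f, A e f * (B h k * X e f h k) :=
        Finset.sum_congr rfl fun h _ => Finset.sum_congr rfl fun e _ => Finset.sum_comm
    _ = ∑ h, ∑ k, ∑ e, ∑ f, A e f * (B h k * X e f h k) :=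
        Finset.sum_congr rfl fun h _ => Finset.sum_comm
    _ = _ := Finset.sum_congr rfl fun h _ => Finset.sum_congr rfl fun k _ =>
        Finset.sum_congr rfl fun e _ => Finset.sum_congr rfl fun f _ => by ring

theorem double_sum_symm (A : ι → ι → ℝ) (hA : ∀ e f, A e f = A f e) (X : ι → ι → ℝ) :
    ∑ e, ∑ f, A e f * X e f = ∑ e, ∑ f, A e f * X f e := by
  rw [Finset.sum_comm]
  exact Finset.sum_congr rfl fun e _ => Finset.sum_congr rfl fun f _ => by rw [hA]

end DoubleSum

theorem exists_isPotentialTrace (hφ : φ ∈ IsManifold.maximalAtlas (𝓡 n) ω M)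
    (g : AnalyticMetric n M) {U : Set M} (hUs : U ⊆ φ.source) (Y' : TensorField n 5 M)
    (Z' : TensorField n 3 M) :
    ∃ (Y : TensorField n 3 M) (Z : TensorField n 1 M), IsPotentialTrace g φ U Y' Z' Y Z :=
  ⟨ofComp φ fun u I => (∑ e, ∑ f, gUp g φ u e f * comp φ Y' u ![e, I 0, f, I 1, I 2])
      + comp φ Z' u ![I 1, I 2, I 0],
    ofComp φ fun u I => ∑ e, ∑ f, gUp g φ u e f * comp φ Z' u ![e, I 0, f],
    fun x hx c a b => by rw [comp_ofComp hφ _ (φ.map_source (hUs hx))]; simp,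
    fun x hx a => by rw [comp_ofComp hφ _ (φ.map_source (hUs hx))]; simp⟩

/-- The traced terms `-Z'_{eab}{}^{;e}` and `-Z'_{eba}{}^{;e}` equal the divergences of the `Z'`
summands of `Y_{bae}` and `Y_{abe}`; the terms `Z'_{ea}{}^{e}{}_{;b}` and `Z'_{eb}{}^{e}{}_{;a}` are
derivatives of the traced one-form. -/
theorem IsPotentialTrace.isRicciPotential (hφ : φ ∈ IsManifold.maximalAtlas (𝓡 n) ω M)
    {g : AnalyticMetric n M} {U : Set M} (hU : IsOpen U) (hUs : U ⊆ φ.source)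
    {R' : TensorField n 4 M} {R : TensorField n 2 M} (hR : IsRicciTrace g φ U R' R)
    {Y' : TensorField n 5 M} {Z' Y : TensorField n 3 M} {Z : TensorField n 1 M}
    (hP : IsRiemannPotential g φ U R' Y' Z') (hT : IsPotentialTrace g φ U Y' Z' Y Z) :
    IsRicciPotential g φ U R Y Z := by
  have hZanti : ∀ x ∈ U, ∀ a b c : Fin n,
      comp φ Z' (φ x) ![a, b, c] = -comp φ Z' (φ x) ![b, a, c] := by
    intro x hx a b c
    simp only [comp_three hφ (hUs hx)]
    exact hP.double_form_Z x hx _ _ _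
  have hgs : ∀ x ∈ U, ∀ e f, gUp g φ (φ x) e f = gUp g φ (φ x) f e := fun x hx e f =>
    gUp_comm hφ g (hUs hx) e f
  have hYcomp : ∀ x ∈ U, ∀ a b c : Fin n,
      comp φ Y (φ x) ![a, b, c] = -comp φ Y (φ x) ![a, c, b] := by
    intro x hx a b c
    rw [hT.1 x hx, hT.1 x hx, hZanti x hx b c a]
    have : ∀ e f, comp φ Y' (φ x) ![e, a, f, b, c] = -comp φ Y' (φ x) ![e, a, f, c, b] := by
      intro e f
      simp only [comp_five hφ (hUs hx)]
      exact hP.double_form_Y_de x hx _ _ _ _ _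
    simp only [this, mul_neg, Finset.sum_neg_distrib]
    ring
  have hcyc : ∀ x ∈ U, ∀ a b c : Fin n, comp φ Y (φ x) ![a, b, c] + comp φ Y (φ x) ![b, c, a]
      + comp φ Y (φ x) ![c, a, b] = 0 := by
    intro x hx a b c
    have hxs := hUs hx
    have hZcyc : comp φ Z' (φ x) ![a, b, c] + comp φ Z' (φ x) ![b, c, a]
        + comp φ Z' (φ x) ![c, a, b] = 0 := by
      let w : Fin 3 → TangentSpace (𝓡 n) x :=
        ![coordBasis hφ hxs a, coordBasis hφ hxs b, coordBasis hφ hxs c]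
      have h := hP.alt_Z_eq_zero x hx w
      rw [sum_sign_perm_three (fun i j k => Z' x ![w i, w j, w k])] at h
      dsimp only [w] at h
      simp only [Matrix.cons_val_zero, Matrix.cons_val_one, Matrix.cons_val] at h
      simp only [← comp_three hφ hxs] at h
      linarith [hZanti x hx a c b, hZanti x hx b a c, hZanti x hx c b a]
    -- The four-term form of `Y'_{e[fabc]} = 0`: the three terms with `f` moved behind one of `a, b,
    -- c` are the cyclic sum to be traced.
    have hYcyc : ∀ e f : Fin n, comp φ Y' (φ x) ![e, a, f, b, c]
        + comp φ Y' (φ x) ![e, b, f, c, a] + comp φ Y' (φ x) ![e, c, f, a, b]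
        = comp φ Y' (φ x) ![e, f, a, b, c] := by
      intro e f
      let w : Fin 4 → TangentSpace (𝓡 n) x :=
        ![coordBasis hφ hxs f, coordBasis hφ hxs a, coordBasis hφ hxs b, coordBasis hφ hxs c]
      have h := hP.alt_Y_eq_zero x hx (coordBasis hφ hxs e) w
      rw [sum_sign_perm_four (fun i j k l => Y' x ![coordBasis hφ hxs e, w i, w j, w k, w l])
        (fun i j k l => hP.double_form_Y_cd x hx _ _ _ _ _)
        (fun i j k l => hP.double_form_Y_de x hx _ _ _ _ _)] at h
      dsimp only [w] at h
      simp only [Matrix.cons_val_zero, Matrix.cons_val_one, Matrix.cons_val] at h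
      simp only [← comp_five hφ hxs] at h
      have h2 : comp φ Y' (φ x) ![e, b, f, c, a] = -comp φ Y' (φ x) ![e, b, f, a, c] := by
        simp only [comp_five hφ hxs]
        exact hP.double_form_Y_de x hx _ _ _ _ _
      linarith
    -- The array is antisymmetric in `e, f` while `g^{ef}` is symmetric, so the contraction equals
    -- its own negative.
    have hzero : ∑ e, ∑ f, gUp g φ (φ x) e f * comp φ Y' (φ x) ![e, f, a, b, c] = 0 := by
      have h2 : ∑ e, ∑ f, gUp g φ (φ x) e f * comp φ Y' (φ x) ![e, f, a, b, c] =
          -∑ e, ∑ f, gUp g φ (φ x) e f * comp φ Y' (φ x) ![e, f, a, b, c] := by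
        conv_lhs => rw [Finset.sum_comm]
        simp only [← Finset.sum_neg_distrib]
        refine Finset.sum_congr rfl fun e _ => Finset.sum_congr rfl fun f _ => ?_
        have h3 : comp φ Y' (φ x) ![f, e, a, b, c] = -comp φ Y' (φ x) ![e, f, a, b, c] := by
          simp only [comp_five hφ hxs]
          exact hP.double_form_Y_ab x hx _ _ _ _ _
        rw [h3, hgs x hx f e, mul_neg]
      linarith
    simp only [← hYcyc, mul_add, Finset.sum_add_distrib] at hzero
    rw [hT.1 x hx, hT.1 x hx, hT.1 x hx]
    linarith
  refine ⟨?_, ?_, fun x hx => antisymm_of_comp hφ (hUs hx) Y (hYcomp x hx),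
    fun x hx => alternation_eq_zero_of_comp hφ (hUs hx) Y (hYcomp x hx) (hcyc x hx), ?_⟩
  · intro I x hx
    have hI : I = ![I 0, I 1, I 2] := by funext s; fin_cases s <;> rfl
    rw [hI]
    have hev := eventually_nhds_chart (hUs hx) hU hx
      (P := fun u => (∑ e, ∑ f, gUp g φ u e f * comp φ Y' u ![e, I 0, f, I 1, I 2])
        + comp φ Z' u ![I 1, I 2, I 0] = comp φ Y u ![I 0, I 1, I 2])
      fun y hy => (hT.1 y hy _ _ _).symm
    refine AnalyticAt.congr ?_ hev
    exact (Finset.analyticAt_fun_sum _ fun e _ => Finset.analyticAt_fun_sum _ fun f _ =>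
      (analyticAt_gUp hφ g (hUs hx) e f).mul (hP.analytic_Y _ x hx)).add (hP.analytic_Z _ x hx)
  · intro I x hx
    have hI : I = ![I 0] := by funext s; fin_cases s; rfl
    rw [hI]
    have hev := eventually_nhds_chart (hUs hx) hU hx
      (P := fun u => ∑ e, ∑ f, gUp g φ u e f * comp φ Z' u ![e, I 0, f] = comp φ Z u ![I 0])
      fun y hy => (hT.2 y hy _).symm
    refine AnalyticAt.congr ?_ hev
    exact Finset.analyticAt_fun_sum _ fun e _ => Finset.analyticAt_fun_sum _ fun f _ =>
      (analyticAt_gUp hφ g (hUs hx) e f).mul (hP.analytic_Z _ x hx)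
  · intro x hx a b
    have hxs := hUs hx
    rw [hR x hx]
    simp only [hP.eq x hx, covD_trace_one hφ hxs hU hx hP.analytic_Z hT.2,
      covD_trace_three hφ hxs hU hx hP.analytic_Y hP.analytic_Z hT.1]
    set G := gUp g φ (φ x) with hG
    have hGs : ∀ e f, G e f = G f e := hgs x hx
    have hDZ : ∀ a b c j : Fin n,
        covD g φ Z' (φ x) ![a, b, c] j = -covD g φ Z' (φ x) ![b, a, c] j := fun a b c j =>
      covD_antisymm_three hxs hU hx hZanti a b c j
    -- From here on the covariant derivatives enter only as arrays: all that remains is the symmetry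
    -- of `G`, the antisymmetry of `DZ`, and interchanging finite sums.
    generalize covD g φ Z' (φ x) = DZ at *
    generalize covD g φ Y' (φ x) = DY at *
    have s1 : ∑ e, ∑ f, G e f * ∑ h, ∑ k, G h k * DY ![e, a, f, b, h] k =
        ∑ h, ∑ k, G h k * ∑ e, ∑ f, G e f * DY ![e, a, f, b, h] k :=
      double_sum_mul_comm G G fun e f h k => DY ![e, a, f, b, h] k
    have s2 : ∑ e, ∑ f, G e f * ∑ h, ∑ k, G h k * DY ![f, b, e, a, h] k =
        ∑ h, ∑ k, G h k * ∑ e, ∑ f, G e f * DY ![e, b, f, a, h] k := by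
      rw [double_sum_mul_comm G G fun e f h k => DY ![f, b, e, a, h] k]
      exact Finset.sum_congr rfl fun h _ => Finset.sum_congr rfl fun k _ => by
        rw [double_sum_symm G hGs]
    have s3 : ∑ e, ∑ f, G e f * DZ ![f, b, e] a = ∑ e, ∑ f, G e f * DZ ![e, b, f] a :=
      double_sum_symm G hGs fun e f => DZ ![f, b, e] a
    have s4 : ∑ e, ∑ f, G e f * DZ ![e, a, b] f = -∑ e, ∑ f, G e f * DZ ![a, e, b] f := by
      simp only [← Finset.sum_neg_distrib, ← mul_neg, ← hDZ]
    have s5 : ∑ e, ∑ f, G e f * DZ ![f, b, a] e = -∑ e, ∑ f, G e f * DZ ![b, e, a] f := by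
      rw [double_sum_symm G hGs fun e f => DZ ![f, b, a] e]
      simp only [← Finset.sum_neg_distrib, ← mul_neg, ← hDZ]
    have hpull : ∀ F : Fin n → Fin n → ℝ, ∑ e, ∑ f, G e f * (1 / 2 * F e f) =
        1 / 2 * ∑ e, ∑ f, G e f * F e f := by
      intro F
      simp only [Finset.mul_sum]
      exact Finset.sum_congr rfl fun e _ => Finset.sum_congr rfl fun f _ => by ring
    rw [hpull]
    congr 1
    have expand : ∀ A B C D E F : Fin n → Fin n → ℝ,
        ∑ e, ∑ f, G e f * (A e f + B e f + (C e f - D e f) + (E e f - F e f)) =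
        (∑ e, ∑ f, G e f * A e f) + (∑ e, ∑ f, G e f * B e f) + (∑ e, ∑ f, G e f * C e f)
        - (∑ e, ∑ f, G e f * D e f) + (∑ e, ∑ f, G e f * E e f) - ∑ e, ∑ f, G e f * F e f := by
      intro A B C D E F
      simp only [mul_add, mul_sub, Finset.sum_add_distrib, Finset.sum_sub_distrib]
      ring
    have expand₂ : ∀ A B : Fin n → Fin n → ℝ, ∑ e, ∑ f, G e f * (A e f + B e f) =
        (∑ e, ∑ f, G e f * A e f) + ∑ e, ∑ f, G e f * B e f := by
      intro A B
      simp only [mul_add, Finset.sum_add_distrib]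
    rw [expand (fun e f => ∑ h, ∑ k, G h k * DY ![e, a, f, b, h] k), s1, s2, s3, s4, s5, expand₂,
      expand₂]
    ring

end RicciTrace

end

/-! ### Weighted `ℓ¹` norms and the Neumann series -/

noncomputable section

open Filter Topology
open scoped ENNReal NNReal Nat

section WeightedNorm

variable {κ : Type*}

/-- The weighted `ℓ¹` norm of a family of reals, with values in `[0, ∞]`. -/
def wnorm (w : κ → ℝ≥0) (u : κ → ℝ) : ℝ≥0∞ := ∑' k, ‖u k‖ₑ * w k

theorem wnorm_add_le (w : κ → ℝ≥0) (u v : κ → ℝ) :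
    wnorm w (u + v) ≤ wnorm w u + wnorm w v := by
  rw [wnorm, wnorm, wnorm, ← ENNReal.tsum_add]
  refine ENNReal.tsum_le_tsum fun k => ?_
  rw [← add_mul]
  gcongr
  exact enorm_add_le _ _

theorem wnorm_neg (w : κ → ℝ≥0) (u : κ → ℝ) : wnorm w (-u) = wnorm w u := by
  simp [wnorm]

theorem wnorm_sub_le (w : κ → ℝ≥0) (u v : κ → ℝ) :
    wnorm w (u - v) ≤ wnorm w u + wnorm w v := by
  rw [sub_eq_add_neg, ← wnorm_neg w v]
  exact wnorm_add_le w u (-v)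

theorem wnorm_zero (w : κ → ℝ≥0) : wnorm w 0 = 0 := by simp [wnorm]

theorem wnorm_sum_le {ι : Type*} (w : κ → ℝ≥0) (s : Finset ι) (u : ι → κ → ℝ) :
    wnorm w (∑ i ∈ s, u i) ≤ ∑ i ∈ s, wnorm w (u i) :=
  Finset.le_sum_of_subadditive _ (wnorm_zero w).le (wnorm_add_le w) s u

theorem wnorm_smul (w : κ → ℝ≥0) (c : ℝ) (u : κ → ℝ) :
    wnorm w (c • u) = ‖c‖ₑ * wnorm w u := by
  simp [wnorm, ← ENNReal.tsum_mul_left, enorm_mul, mul_assoc]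

theorem eq_zero_of_wnorm_eq_zero {w : κ → ℝ≥0} (hw : ∀ k, w k ≠ 0) {u : κ → ℝ}
    (h : wnorm w u = 0) : u = 0 := by
  funext k
  have := ENNReal.tsum_eq_zero.1 h k
  simpa [hw k] using this

/-- A linear contraction for a weighted `ℓ¹` norm has the usual Neumann series fixed point. -/
theorem exists_fixedPoint_of_wnorm_le {w : κ → ℝ≥0} (hw : ∀ k, w k ≠ 0)
    (K : (κ → ℝ) →ₗ[ℝ] (κ → ℝ)) {θ : ℝ≥0} (hθ : θ < 1)
    (hK : ∀ u, wnorm w (K u) ≤ θ * wnorm w u) {f : κ → ℝ} (hf : wnorm w f ≠ ⊤) :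
    ∃ v, wnorm w v ≠ ⊤ ∧ v = f + K v := by
  -- Terms of the Neumann series. The norm takes values in `[0, ∞]` and `K` acts on all families, so
  -- convergence is established coordinatewise instead of in a normed space.
  set S : ℕ → κ → ℝ := fun m => (K ^ m) f with hS
  have hSn : ∀ m, wnorm w (S m) ≤ (θ : ℝ≥0∞) ^ m * wnorm w f := by
    intro m
    induction m with
    | zero => simp [hS]
    | succ m ih =>
      calc wnorm w (S (m + 1)) = wnorm w (K (S m)) := by
            simp only [hS, pow_succ', Module.End.mul_apply]
        _ ≤ θ * wnorm w (S m) := hK _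
        _ ≤ θ * ((θ : ℝ≥0∞) ^ m * wnorm w f) := by gcongr
        _ = _ := by rw [pow_succ', mul_assoc]
  have htot : ∑' m, wnorm w (S m) ≠ ⊤ := by
    refine ne_top_of_le_ne_top ?_ (ENNReal.tsum_le_tsum hSn)
    rw [ENNReal.tsum_mul_right, ENNReal.tsum_geometric]
    refine ENNReal.mul_ne_top (ENNReal.inv_ne_top.2 ?_) hf
    exact (tsub_pos_of_lt (by exact_mod_cast hθ)).ne'
  have hcoord : ∀ k, Summable fun m => S m k := by
    intro k
    refine Summable.of_enorm ?_
    intro htop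
    apply htot
    have h1 : (∑' m, ‖S m k‖ₑ) * w k ≤ ∑' m, wnorm w (S m) := by
      rw [← ENNReal.tsum_mul_right]
      exact ENNReal.tsum_le_tsum fun m => ENNReal.le_tsum (f := fun k => ‖S m k‖ₑ * w k) k
    rw [htop, ENNReal.top_mul (by simpa using hw k)] at h1
    exact top_le_iff.1 h1
  let v : κ → ℝ := fun k => ∑' m, S m k
  let T : ℕ → κ → ℝ := fun M => ∑ m ∈ Finset.range M, S m
  have htail : ∀ M, wnorm w (v - T M) ≤ ∑' m, wnorm w (S (m + M)) := by
    intro M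
    have : ∀ k, (v - T M) k = ∑' m, S (m + M) k := by
      intro k
      simp only [v, T, Pi.sub_apply, Finset.sum_apply]
      rw [← (hcoord k).sum_add_tsum_nat_add M]
      ring
    simp only [wnorm, this]
    rw [ENNReal.tsum_comm]
    refine ENNReal.tsum_le_tsum fun k => ?_
    rw [ENNReal.tsum_mul_right]
    gcongr
    exact enorm_tsum_le_tsum_enorm
  have hlim : Tendsto (fun M => wnorm w (v - T M)) atTop (𝓝 0) :=
    tendsto_of_tendsto_of_tendsto_of_le_of_le tendsto_const_nhds
      (ENNReal.tendsto_sum_nat_add (fun m => wnorm w (S m)) htot) (fun _ => zero_le) htail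
  have hstep : ∀ M, T (M + 1) = f + K (T M) := by
    intro M
    simp only [T, Finset.sum_range_succ', map_sum]
    rw [add_comm]
    congr 1
    exact Finset.sum_congr rfl fun m _ => by simp only [hS, pow_succ', Module.End.mul_apply]
  refine ⟨v, ?_, ?_⟩
  · have := htail 0
    simp only [T, Finset.range_zero, Finset.sum_empty, sub_zero, add_zero] at this
    exact ne_top_of_le_ne_top htot this
  · rw [← sub_eq_zero]
    apply eq_zero_of_wnorm_eq_zero hw
    -- `K` is not assumed to commute with coordinatewise limits. The contraction bound applied to
    -- the tail `v - T M` replaces that.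
    have hle : ∀ M, wnorm w (v - (f + K v)) ≤ wnorm w (v - T (M + 1)) + θ * wnorm w (v - T M) := by
      intro M
      have : v - (f + K v) = (v - T (M + 1)) - K (v - T M) := by
        rw [hstep, map_sub]; abel
      rw [this]
      exact (wnorm_sub_le _ _ _).trans (add_le_add le_rfl (hK _))
    have hlim2 : Tendsto (fun M => wnorm w (v - T (M + 1)) + θ * wnorm w (v - T M)) atTop
        (𝓝 (0 + θ * 0)) :=
      (hlim.comp (tendsto_add_atTop_nat 1)).add
        (ENNReal.Tendsto.const_mul hlim (Or.inr (by simp)))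
    simpa using ge_of_tendsto' hlim2 hle

end WeightedNorm

/-! ### Factorial estimates for multi-indices -/

section MultiIndex

variable {σ : Type*} [Fintype σ]

/-- `α! = ∏ αᵢ!`. -/
def mfact (α : σ →₀ ℕ) : ℕ := ∏ i, (α i)!

/-- `ρ^α = ∏ ρᵢ^αᵢ`. -/
def mpow {R : Type*} [CommMonoid R] (ρ : σ → R) (α : σ →₀ ℕ) : R := ∏ i, ρ i ^ α i

theorem mpow_add {R : Type*} [CommMonoid R] (ρ : σ → R) (α β : σ →₀ ℕ) :
    mpow ρ (α + β) = mpow ρ α * mpow ρ β := by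
  simp [mpow, pow_add, Finset.prod_mul_distrib]

theorem mpow_single {R : Type*} [CommMonoid R] (ρ : σ → R) (i : σ) :
    mpow ρ (Finsupp.single i 1) = ρ i := by
  classical
  simp only [mpow]
  rw [Finset.prod_eq_single i (fun j _ hj => by simp [hj.symm]) (by simp)]
  simp

theorem mpow_ne_zero {ρ : σ → ℝ≥0} (hρ : ∀ i, ρ i ≠ 0) (α : σ →₀ ℕ) : mpow ρ α ≠ 0 :=
  Finset.prod_ne_zero_iff.2 fun i _ => pow_ne_zero _ (hρ i)

theorem mfact_ne_zero (α : σ →₀ ℕ) : mfact α ≠ 0 :=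
  Finset.prod_ne_zero_iff.2 fun _ _ => Nat.factorial_ne_zero _

theorem mfact_pos (α : σ →₀ ℕ) : 0 < mfact α := Nat.pos_of_ne_zero (mfact_ne_zero α)

theorem degree_eq_sum (α : σ →₀ ℕ) : α.degree = ∑ i, α i := Finsupp.degree_eq_sum α

theorem factorial_add_eq (a b : ℕ) : (a + b)! = (a + b).choose a * (a ! * b !) := by
  rw [← mul_assoc, Nat.choose_symm_add, Nat.add_choose_mul_factorial_mul_factorial]

/-- A single term of Vandermonde's sum; by iteration, a product of binomials is at most the binomial
of the sums. -/
theorem choose_mul_choose_le (a b c d : ℕ) :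
    a.choose b * c.choose d ≤ (a + c).choose (b + d) := by
  rw [Nat.add_choose_eq]
  exact Finset.single_le_sum (f := fun ij : ℕ × ℕ => a.choose ij.1 * c.choose ij.2)
    (fun _ _ => Nat.zero_le _) (Finset.HasAntidiagonal.mem_antidiagonal.2 (rfl : (b, d).1 + (b, d).2 = b + d))

theorem prod_choose_le {ι : Type*} (s : Finset ι) (a b : ι → ℕ) :
    ∏ i ∈ s, (a i + b i).choose (a i) ≤ (∑ i ∈ s, a i + ∑ i ∈ s, b i).choose (∑ i ∈ s, a i) := by
  classical
  induction s using Finset.induction_on with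
  | empty => simp
  | insert i s hi ih =>
    rw [Finset.prod_insert hi, Finset.sum_insert hi, Finset.sum_insert hi]
    calc _ ≤ _ := Nat.mul_le_mul_left _ ih
      _ ≤ _ := choose_mul_choose_le _ _ _ _
      _ = _ := by congr 1; ring

/-- In binomial form: the multi-index binomial of `α + β` over `α` is at most the ordinary binomial
of `|α| + |β|` over `|α|`. This makes the weights `ρ^α / |α|!` submultiplicative for the Leibniz
product. -/
theorem mfact_add_le (α β : σ →₀ ℕ) :
    mfact (α + β) * ((α.degree)! * (β.degree)!) ≤ ((α + β).degree)! * (mfact α * mfact β) := by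
  have h1 : mfact (α + β) = (∏ i, (α i + β i).choose (α i)) * (mfact α * mfact β) := by
    simp only [mfact, ← Finset.prod_mul_distrib]
    refine Finset.prod_congr rfl fun i _ => ?_
    rw [Finsupp.add_apply, factorial_add_eq]
  have h2 : ((α + β).degree)! =
      (α.degree + β.degree).choose α.degree * ((α.degree)! * (β.degree)!) := by
    rw [map_add, factorial_add_eq]
  have h3 := prod_choose_le Finset.univ (fun i => α i) (fun i => β i)
  rw [← degree_eq_sum, ← degree_eq_sum] at h3
  rw [h1, h2]
  calc _ = (∏ i, (α i + β i).choose (α i)) *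
        ((mfact α * mfact β) * ((α.degree)! * (β.degree)!)) := by ring
    _ ≤ (α.degree + β.degree).choose α.degree *
        ((mfact α * mfact β) * ((α.degree)! * (β.degree)!)) := by gcongr
    _ = _ := by ring

theorem mfact_le (α : σ →₀ ℕ) : mfact α ≤ (α.degree)! := by
  rw [degree_eq_sum]
  exact Nat.le_of_dvd (Nat.factorial_pos _) (Nat.prod_factorial_dvd_factorial_sum _ _)

/-- Each binomial coefficient met when adding one more index is at most a power of two. Thus `|α|!`
and `α!` differ only geometrically, which costs no more than a change of radius. -/
theorem factorial_sum_le {ι : Type*} (s : Finset ι) (a : ι → ℕ) :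
    (∑ i ∈ s, a i)! ≤ (2 ^ s.card) ^ (∑ i ∈ s, a i) * ∏ i ∈ s, (a i)! := by
  classical
  induction s using Finset.induction_on with
  | empty => simp
  | insert i s hi ih =>
    rw [Finset.prod_insert hi, Finset.sum_insert hi, Finset.card_insert_of_notMem hi,
      factorial_add_eq]
    set S := ∑ i ∈ s, a i
    calc (a i + S).choose (a i) * ((a i)! * S !)
        ≤ 2 ^ (a i + S) * ((a i)! * ((2 ^ s.card) ^ S * ∏ i ∈ s, (a i)!)) := by
          gcongr
          exact Nat.choose_le_two_pow _ _
      _ ≤ 2 ^ (a i + S) * ((a i)! * ((2 ^ s.card) ^ (a i + S) * ∏ i ∈ s, (a i)!)) := by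
          gcongr
          · exact Nat.one_le_two_pow
          · omega
      _ = _ := by rw [pow_succ (2 : ℕ) s.card, mul_pow (2 ^ s.card) 2]; ring

theorem factorial_degree_le (α : σ →₀ ℕ) :
    (α.degree)! ≤ (2 ^ Fintype.card σ) ^ α.degree * mfact α := by
  rw [degree_eq_sum]
  exact factorial_sum_le Finset.univ _

end MultiIndex

/-! ### Integration, differentiation and products of Taylor coefficients -/

section FormalSeries

variable {σ : Type*} [Fintype σ]

/-- The weight `ρ^α / |α|!`. -/
def wt (ρ : σ → ℝ≥0) (α : σ →₀ ℕ) : ℝ≥0 := mpow ρ α / (α.degree)!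

theorem wt_ne_zero {ρ : σ → ℝ≥0} (hρ : ∀ i, ρ i ≠ 0) (α : σ →₀ ℕ) : wt ρ α ≠ 0 :=
  div_ne_zero (mpow_ne_zero hρ α) (by exact_mod_cast Nat.factorial_ne_zero _)

/-- `v ↦ ∂^δ ∂^{-η} v` on families of Taylor coefficients (derivatives at the origin), where
`∂^{-η}` is the iterated integral vanishing on coordinate hyperplanes. -/
def shift (η δ : σ →₀ ℕ) : ((σ →₀ ℕ) → ℝ) →ₗ[ℝ] ((σ →₀ ℕ) → ℝ) where
  toFun v α := open Classical in if η ≤ α + δ then v (α + δ - η) else 0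
  map_add' u v := by funext α; simp only [Pi.add_apply]; split_ifs <;> simp
  map_smul' c v := by funext α; simp only [Pi.smul_apply, RingHom.id_apply]; split_ifs <;> simp

omit [Fintype σ] in
theorem shift_self (η : σ →₀ ℕ) (v : (σ →₀ ℕ) → ℝ) : shift η η v = v := by
  funext α; simp [shift]

/-- If `α + δ = η + γ`, then `ρ^α = (ρ^η / ρ^δ) ρ^γ` and `|γ| ≤ |α|`, so replacing `|α|!` by `|γ|!`
only enlarges the weight. The factorial of the total degree is essential: with `α!` in the weight,
`∂_k∂_i^{-1}` would be unbounded for `k ≠ i`. -/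
theorem wnorm_shift_le {ρ : σ → ℝ≥0} (hρ : ∀ i, ρ i ≠ 0) {η δ : σ →₀ ℕ}
    (h : δ.degree ≤ η.degree) (v : (σ →₀ ℕ) → ℝ) :
    wnorm (wt ρ) (shift η δ v) ≤ (mpow ρ η / mpow ρ δ : ℝ≥0) * wnorm (wt ρ) v := by
  classical
  set c := mpow ρ η / mpow ρ δ with hc
  have hwt : ∀ α, η ≤ α + δ → wt ρ α ≤ c * wt ρ (α + δ - η) := by
    intro α hα
    obtain ⟨γ, hγ⟩ := exists_add_of_le hα
    have h1 : α + δ - η = γ := by rw [hγ, add_tsub_cancel_left]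
    have h2 : mpow ρ α * mpow ρ δ = mpow ρ η * mpow ρ γ := by rw [← mpow_add, hγ, mpow_add]
    have h3 : mpow ρ α = c * mpow ρ γ := by
      rw [hc, div_mul_eq_mul_div, ← h2, mul_div_cancel_right₀ _ (mpow_ne_zero hρ δ)]
    have h4 : γ.degree ≤ α.degree := by
      have := congrArg Finsupp.degree hγ
      simp only [map_add] at this
      omega
    rw [h1, wt, wt, h3, mul_div_assoc]
    gcongr
  have hterm : ∀ α, ‖shift η δ v α‖ₑ * wt ρ α ≤
      c * ({α | η ≤ α + δ}.indicator (fun α => ‖v (α + δ - η)‖ₑ * wt ρ (α + δ - η)) α) := by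
    intro α
    by_cases hα : η ≤ α + δ
    · have : shift η δ v α = v (α + δ - η) := by simp [shift, hα]
      rw [this, Set.indicator_of_mem (by exact hα), mul_left_comm]
      gcongr
      exact_mod_cast hwt α hα
    · simp [shift, hα]
  refine (ENNReal.tsum_le_tsum hterm).trans ?_
  rw [ENNReal.tsum_mul_left]
  gcongr
  rw [← tsum_subtype]
  -- Where it is not truncated, `α ↦ α + δ - η` is injective, so each coefficient of `v` is counted
  -- at most once.
  refine ENNReal.tsum_comp_le_tsum_of_injective
    (f := fun α : {α : σ →₀ ℕ | η ≤ α + δ} => (α : σ →₀ ℕ) + δ - η) ?_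
    (fun γ => ‖v γ‖ₑ * wt ρ γ)
  rintro ⟨α, hα⟩ ⟨β, hβ⟩ hab
  simp only [Set.mem_ofPred_eq] at hα hβ hab
  have : α + δ = β + δ := by rw [← tsub_add_cancel_of_le hα, hab, tsub_add_cancel_of_le hβ]
  exact Subtype.ext (add_right_cancel this)

/-- The Leibniz product of two families of Taylor coefficients. -/
def leibniz [DecidableEq σ] (f : (σ →₀ ℕ) → ℝ) : ((σ →₀ ℕ) → ℝ) →ₗ[ℝ] ((σ →₀ ℕ) → ℝ) where
  toFun v α := ∑ p ∈ Finset.HasAntidiagonal.antidiagonal α,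
    (mfact α / (mfact p.1 * mfact p.2) : ℝ) * (f p.1 * v p.2)
  map_add' u v := by
    funext α
    simp only [Pi.add_apply, ← Finset.sum_add_distrib]
    exact Finset.sum_congr rfl fun p _ => by ring
  map_smul' c v := by
    funext α
    simp only [Pi.smul_apply, RingHom.id_apply, smul_eq_mul, Finset.mul_sum]
    exact Finset.sum_congr rfl fun p _ => by ring

/-- Termwise this is `mfact_add_le`; summing over all `α` and all decompositions `α = β + γ` is
summing over all pairs. -/
theorem wnorm_leibniz_le [DecidableEq σ] (ρ : σ → ℝ≥0) (f v : (σ →₀ ℕ) → ℝ) :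
    wnorm (wt ρ) (leibniz f v) ≤ wnorm (wt ρ) f * wnorm (wt ρ) v := by
  have hterm : ∀ α, ‖leibniz f v α‖ₑ * wt ρ α ≤
      ∑ p ∈ Finset.HasAntidiagonal.antidiagonal α, (‖f p.1‖ₑ * wt ρ p.1) * (‖v p.2‖ₑ * wt ρ p.2) := by
    intro α
    refine (mul_le_mul' (enorm_sum_le _ _) le_rfl).trans ?_
    rw [Finset.sum_mul]
    refine Finset.sum_le_sum fun p hp => ?_
    obtain ⟨β, γ⟩ := p
    obtain rfl := Finset.HasAntidiagonal.mem_antidiagonal.1 hp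
    dsimp only
    rw [enorm_mul, enorm_mul]
    have h0 : (mfact (β + γ) / (mfact β * mfact γ) : ℝ) =
        ((mfact (β + γ) / (mfact β * mfact γ) : ℝ≥0) : ℝ) := by push_cast; rfl
    have h1 : (mfact (β + γ) / (mfact β * mfact γ) : ℝ≥0) * wt ρ (β + γ) ≤ wt ρ β * wt ρ γ := by
      have hb := mfact_ne_zero β
      have hc := mfact_ne_zero γ
      have := mfact_add_le β γ
      rw [wt, wt, wt, mpow_add, div_mul_div_comm, div_mul_div_comm, div_le_div_iff₀
        (by positivity [mfact_pos β, mfact_pos γ]) (by positivity)]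
      have h2 : ((mfact (β + γ) * ((β.degree)! * (γ.degree)!) : ℕ) : ℝ≥0) ≤
        ((((β + γ).degree)! * (mfact β * mfact γ) : ℕ) : ℝ≥0) := by exact_mod_cast this
      push_cast at h2
      calc _ = (mpow ρ β * mpow ρ γ) * (mfact (β + γ) * ((β.degree)! * (γ.degree)!)) := by ring
        _ ≤ (mpow ρ β * mpow ρ γ) * (((β + γ).degree)! * (mfact β * mfact γ)) := by gcongr
        _ = _ := by ring
    rw [h0, NNReal.enorm_eq]
    calc _ = (‖f β‖ₑ * ‖v γ‖ₑ) *
          (((mfact (β + γ) / (mfact β * mfact γ) : ℝ≥0) * wt ρ (β + γ) : ℝ≥0) : ℝ≥0∞) := by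
          push_cast; ring
      _ ≤ (‖f β‖ₑ * ‖v γ‖ₑ) * ((wt ρ β * wt ρ γ : ℝ≥0) : ℝ≥0∞) := by gcongr
      _ = _ := by push_cast; ring
  refine (ENNReal.tsum_le_tsum hterm).trans_eq ?_
  rw [wnorm, wnorm, ← ENNReal.tsum_mul_right]
  simp_rw [← ENNReal.tsum_mul_left]
  rw [← ENNReal.tsum_prod (f := fun β γ => (‖f β‖ₑ * wt ρ β) * (‖v γ‖ₑ * wt ρ γ)),
    ← Finset.HasAntidiagonal.sigmaAntidiagonalEquivProd.tsum_eq, ENNReal.tsum_sigma']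
  refine tsum_congr fun α => ?_
  rw [tsum_fintype, ← Finset.sum_coe_sort]
  rfl

end FormalSeries

end

/-! ### From Taylor coefficients to analytic functions -/

noncomputable section

open Filter Topology
open scoped ENNReal NNReal Nat

section Evaluation

variable {n : ℕ}

/-- The weight `r^|α| / α!`. -/
def wtDiag (r : ℝ≥0) (α : Fin n →₀ ℕ) : ℝ≥0 := r ^ α.degree / mfact α

/-- Together with `wtDiag_le_wt` this relates the weights adapted to inverting derivatives to those
expressing absolute convergence on a polydisc, at the cost of a factor `2 ^ n` in the radius. -/
theorem wt_le_wtDiag {ρ : Fin n → ℝ≥0} {r : ℝ≥0} (h : ∀ i, ρ i ≤ r) (α : Fin n →₀ ℕ) :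
    wt ρ α ≤ wtDiag r α := by
  rw [wt, wtDiag]
  have h1 : mpow ρ α ≤ r ^ α.degree := by
    rw [degree_eq_sum, ← Finset.prod_pow_eq_pow_sum]
    exact Finset.prod_le_prod' fun i _ => pow_le_pow_left' (h i) _
  have h2 : (0 : ℝ≥0) < mfact α := by exact_mod_cast mfact_pos α
  have h3 : (mfact α : ℝ≥0) ≤ ((α.degree)! : ℕ) := by exact_mod_cast mfact_le α
  gcongr

theorem wtDiag_le_wt {ρ : Fin n → ℝ≥0} {r : ℝ≥0} (h : ∀ i, r * 2 ^ n ≤ ρ i)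
    (α : Fin n →₀ ℕ) : wtDiag r α ≤ wt ρ α := by
  rw [wt, wtDiag]
  have h1 : (r * 2 ^ n) ^ α.degree ≤ mpow ρ α := by
    rw [degree_eq_sum, ← Finset.prod_pow_eq_pow_sum]
    exact Finset.prod_le_prod' fun i _ => pow_le_pow_left' (h i) _
  have h2 : (0 : ℝ≥0) < mfact α := by exact_mod_cast mfact_pos α
  have h3 : (((α.degree)! : ℕ) : ℝ≥0) ≤ (2 ^ n) ^ α.degree * mfact α := by
    have := factorial_degree_le α
    rw [Fintype.card_fin] at this
    exact_mod_cast this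
  rw [div_le_div_iff₀ h2 (by positivity)]
  calc _ ≤ r ^ α.degree * ((2 ^ n) ^ α.degree * mfact α) := by gcongr
    _ = (r * 2 ^ n) ^ α.degree * mfact α := by rw [mul_pow]; ring
    _ ≤ _ := by gcongr

theorem wnorm_mono {κ : Type*} {w w' : κ → ℝ≥0} (h : ∀ k, w k ≤ w' k) (u : κ → ℝ) :
    wnorm w u ≤ wnorm w' u :=
  ENNReal.tsum_le_tsum fun k => by gcongr; exact h k

/-- The terms of the power series with Taylor coefficients `a`. -/
def seriesTerm (a : (Fin n →₀ ℕ) → ℝ) (x : Model n) (α : Fin n →₀ ℕ) : ℝ :=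
  a α * (mpow (fun i => x i) α / mfact α)

theorem abs_mpow_le {r : ℝ≥0} {x : Model n} (hx : ∀ i, |x i| ≤ r) (α : Fin n →₀ ℕ) :
    |mpow (fun i => x i) α| ≤ (r : ℝ) ^ α.degree := by
  rw [mpow, Finset.abs_prod, degree_eq_sum, ← Finset.prod_pow_eq_pow_sum]
  refine Finset.prod_le_prod (fun _ _ => abs_nonneg _) fun i _ => ?_
  rw [abs_pow]
  exact pow_le_pow_left₀ (abs_nonneg _) (hx i) _

theorem summable_wnorm {κ : Type*} {w : κ → ℝ≥0} {a : κ → ℝ} (h : wnorm w a ≠ ⊤) :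
    Summable fun k => |a k| * w k := by
  have := ENNReal.summable_toReal h
  simpa using this

theorem summable_norm_seriesTerm {r : ℝ≥0} {a : (Fin n →₀ ℕ) → ℝ} (ha : wnorm (wtDiag r) a ≠ ⊤)
    {x : Model n} (hx : ∀ i, |x i| ≤ r) : Summable fun α => ‖seriesTerm a x α‖ := by
  refine Summable.of_nonneg_of_le (fun _ => norm_nonneg _) (fun α => ?_) (summable_wnorm ha)
  rw [seriesTerm, norm_mul, norm_div, Real.norm_eq_abs, Real.norm_eq_abs, wtDiag]
  push_cast
  rw [Real.norm_natCast]
  gcongr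
  exact abs_mpow_le hx α

theorem seriesTerm_leibniz_hasSum {r : ℝ≥0} {a b : (Fin n →₀ ℕ) → ℝ}
    (ha : wnorm (wtDiag r) a ≠ ⊤) (hb : wnorm (wtDiag r) b ≠ ⊤)
    {x : Model n} (hx : ∀ i, |x i| ≤ r) {y z : ℝ} (hy : HasSum (seriesTerm a x) y)
    (hz : HasSum (seriesTerm b x) z) : HasSum (seriesTerm (leibniz a b) x) (y * z) := by
  have hsa := summable_norm_seriesTerm ha hx
  have hsb := summable_norm_seriesTerm hb hx
  have hmul := summable_mul_of_summable_norm hsa hsb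
  have hs := summable_sum_mul_antidiagonal_of_summable_mul hmul
  have ht := hsa.of_norm.tsum_mul_tsum_eq_tsum_sum_antidiagonal hsb.of_norm hmul
  have heq : seriesTerm (leibniz a b) x = fun α =>
      ∑ p ∈ Finset.HasAntidiagonal.antidiagonal α, seriesTerm a x p.1 * seriesTerm b x p.2 := by
    funext α
    simp only [seriesTerm, leibniz, LinearMap.coe_mk, AddHom.coe_mk, Finset.sum_mul]
    refine Finset.sum_congr rfl fun p hp => ?_
    obtain ⟨β, γ⟩ := p
    obtain rfl := Finset.HasAntidiagonal.mem_antidiagonal.1 hp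
    have h1 : (mfact (β + γ) : ℝ) ≠ 0 := by exact_mod_cast mfact_ne_zero _
    have h2 : (mfact β : ℝ) ≠ 0 := by exact_mod_cast mfact_ne_zero _
    have h3 : (mfact γ : ℝ) ≠ 0 := by exact_mod_cast mfact_ne_zero _
    dsimp only
    rw [mpow_add]
    field_simp
  rw [heq, ← hy.tsum_eq, ← hz.tsum_eq, ht]
  exact hs.hasSum

/-- The sum of the power series with Taylor coefficients `a`. -/
def evalSeries (a : (Fin n →₀ ℕ) → ℝ) (x : Model n) : ℝ := ∑' α, seriesTerm a x α

theorem hasSum_evalSeries {r : ℝ≥0} {a : (Fin n →₀ ℕ) → ℝ} (ha : wnorm (wtDiag r) a ≠ ⊤)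
    {x : Model n} (hx : ∀ i, |x i| ≤ r) : HasSum (seriesTerm a x) (evalSeries a x) :=
  (summable_norm_seriesTerm ha hx).of_norm.hasSum

theorem abs_coord_le (x : Model n) (i : Fin n) : |x i| ≤ ‖x‖ := by
  simpa using PiLp.norm_apply_le x i

/-- A monomial of degree `k` is the diagonal of a product of `k` coordinate projections. Off degree
`k` the map is a dummy zero, so that a choice can be made for all `α` and `k` at once. -/
theorem exists_monomial (α : Fin n →₀ ℕ) (k : ℕ) :
    ∃ m : ContinuousMultilinearMap ℝ (fun _ : Fin k => Model n) ℝ, ‖m‖ ≤ 1 ∧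
      (α.degree = k → ∀ x : Model n, m (fun _ => x) = mpow (fun i => x i) α) := by
  by_cases h : α.degree = k
  · obtain ⟨w, hw⟩ : ∃ w : Fin k → Fin n, ∀ x : Model n,
        ∏ s, x (w s) = mpow (fun i => x i) α := by
      have hlen : α.toMultiset.toList.length = k := by
        rw [Multiset.length_toList, Finsupp.card_toMultiset, ← h, degree_eq_sum]
        exact Finsupp.sum_fintype _ _ (fun _ => rfl)
      subst hlen
      refine ⟨fun s => α.toMultiset.toList.get s, fun x => ?_⟩
      have h1 : ∏ s, x (α.toMultiset.toList.get s) = (α.toMultiset.toList.map (fun i => x i)).prod := by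
        rw [← List.prod_ofFn]
        congr 1
        exact List.ext_get (by simp) (by simp)
      rw [h1, ← Multiset.prod_coe, ← Multiset.map_coe, Multiset.coe_toList,
        Finsupp.toMultiset_map, Finsupp.prod_toMultiset,
        Finsupp.prod_mapDomain_index (fun _ => pow_zero _) (fun _ _ _ => pow_add _ _ _),
        Finsupp.prod_fintype _ _ (fun _ => pow_zero _), mpow]
    refine ⟨(ContinuousMultilinearMap.mkPiAlgebra ℝ (Fin k) ℝ).compContinuousLinearMap
      (fun s => EuclideanSpace.proj (w s)), ?_, fun _ x => by simpa using hw x⟩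
    refine ContinuousMultilinearMap.opNorm_le_bound zero_le_one fun v => ?_
    simp only [ContinuousMultilinearMap.compContinuousLinearMap_apply,
      ContinuousMultilinearMap.mkPiAlgebra_apply, one_mul, norm_prod]
    exact Finset.prod_le_prod (fun _ _ => norm_nonneg _) fun s _ => abs_coord_le (v s) (w s)
  · exact ⟨0, by simp, fun h' => absurd h' h⟩

theorem hasFPowerSeriesOnBall_evalSeries {r : ℝ≥0} (hr : 0 < r) {a : (Fin n →₀ ℕ) → ℝ}
    (ha : wnorm (wtDiag r) a ≠ ⊤) :
    ∃ p : FormalMultilinearSeries ℝ (Model n) ℝ, HasFPowerSeriesOnBall (evalSeries a) p 0 r := by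
  choose m hm1 hm2 using exists_monomial (n := n)
  let S : ℕ → Finset (Fin n →₀ ℕ) := fun k => Finset.finsuppAntidiag Finset.univ k
  have hS : ∀ k α, α ∈ S k ↔ α.degree = k := by
    intro k α
    simp [S, Finset.mem_finsuppAntidiag, degree_eq_sum]
  let p : FormalMultilinearSeries ℝ (Model n) ℝ := fun k => ∑ α ∈ S k, (a α / mfact α) • m α k
  have hsum := summable_wnorm ha
  refine ⟨p, ?_, by simpa using hr, ?_⟩
  · refine p.le_radius_of_bound (∑' α, |a α| * wtDiag r α) fun k => ?_
    calc ‖p k‖ * (r : ℝ) ^ k ≤ (∑ α ∈ S k, |a α| / mfact α) * (r : ℝ) ^ k := by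
          gcongr
          refine (norm_sum_le _ _).trans (Finset.sum_le_sum fun α _ => ?_)
          rw [norm_smul, norm_div, Real.norm_natCast, Real.norm_eq_abs]
          exact mul_le_of_le_one_right (by positivity) (hm1 α k)
      _ = ∑ α ∈ S k, |a α| * wtDiag r α := by
          rw [Finset.sum_mul]
          refine Finset.sum_congr rfl fun α hα => ?_
          rw [wtDiag, (hS k α).1 hα]
          push_cast
          ring
      _ ≤ _ := hsum.sum_le_tsum _ (fun _ _ => by positivity)
  · intro y hy
    have hy' : ∀ i, |y i| ≤ r := fun i => (abs_coord_le y i).trans (by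
      have : ‖y‖ < r := by simpa using hy
      exact this.le)
    have h := (hasSum_evalSeries ha hy').tsum_fiberwise (fun α => α.degree)
    rw [zero_add]
    convert h using 2 with k
    have hset : (fun α : Fin n →₀ ℕ => α.degree) ⁻¹' {k} = (S k : Set (Fin n →₀ ℕ)) := by
      ext α; simp [hS]
    rw [hset, Finset.tsum_subtype' (S k) (seriesTerm a y)]
    simp only [p, _root_.sum_apply, _root_.smul_apply, smul_eq_mul, seriesTerm]
    refine Finset.sum_congr rfl fun α hα => ?_
    rw [hm2 α k ((hS k α).1 hα)]
    ring

end Evaluation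

end

/-! ### Termwise differentiation and expansion of analytic functions -/

noncomputable section

open Filter Topology
open scoped ENNReal NNReal Nat

section Differentiation

variable {n : ℕ}

/-- The Taylor coefficients of `∂ₖ f` in terms of those of `f`. -/
def shiftUp (k : Fin n) (a : (Fin n →₀ ℕ) → ℝ) : (Fin n →₀ ℕ) → ℝ :=
  fun α => a (α + Finsupp.single k 1)

theorem add_single_injective (k : Fin n) :
    Function.Injective fun α : Fin n →₀ ℕ => α + Finsupp.single k 1 :=
  add_left_injective _

theorem mfact_add_single (α : Fin n →₀ ℕ) (k : Fin n) :
    mfact (α + Finsupp.single k 1) = (α k + 1) * mfact α := by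
  simp only [mfact, ← Finset.mul_prod_erase Finset.univ _ (Finset.mem_univ k)]
  rw [Finsupp.add_apply, Finsupp.single_eq_same, Nat.factorial_succ, mul_assoc]
  congr 2
  refine Finset.prod_congr rfl fun i hi => ?_
  simp [(Finset.ne_of_mem_erase hi)]

theorem le_two_pow_degree (α : Fin n →₀ ℕ) (k : Fin n) : α k + 1 ≤ 2 ^ α.degree :=
  Nat.lt_two_pow_self.trans_le (Nat.pow_le_pow_right two_pos (Finsupp.le_degree k α))

/-- The derivative of the monomial `x^α / α!` in the direction `k`. -/
def monomialDeriv (k : Fin n) (x : Model n) (α : Fin n →₀ ℕ) : ℝ :=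
  α k * x k ^ (α k - 1) * (∏ i ∈ Finset.univ.erase k, x i ^ α i) / mfact α

theorem monomialDeriv_add_single (k : Fin n) (x : Model n) (α : Fin n →₀ ℕ) :
    monomialDeriv k x (α + Finsupp.single k 1) = mpow (fun i => x i) α / mfact α := by
  have h1 : ((α k : ℝ) + 1) ≠ 0 := by positivity
  rw [monomialDeriv, mfact_add_single, mpow, ← Finset.mul_prod_erase Finset.univ _
    (Finset.mem_univ k)]
  have : ∏ i ∈ Finset.univ.erase k, x i ^ (α + Finsupp.single k 1 : Fin n →₀ ℕ) i =
      ∏ i ∈ Finset.univ.erase k, x i ^ α i :=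
    Finset.prod_congr rfl fun i hi => by simp [(Finset.ne_of_mem_erase hi)]
  rw [this]
  simp only [Finsupp.add_apply, Finsupp.single_eq_same, add_tsub_cancel_right]
  push_cast
  rw [mul_assoc, mul_div_mul_left _ _ h1]

theorem hasDerivAt_monomial (k : Fin n) (x : Model n) (α : Fin n →₀ ℕ) (s : ℝ) :
    HasDerivAt (fun t : ℝ => mpow (fun i => (x + t • EuclideanSpace.single k (1 : ℝ)) i) α / mfact α)
      (monomialDeriv k (x + s • EuclideanSpace.single k (1 : ℝ)) α) s := by
  have hk : ∀ t : ℝ, (x + t • EuclideanSpace.single k (1 : ℝ) : Model n) k = x k + t := by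
    intro t; simp
  have hi : ∀ t : ℝ, ∀ i ∈ Finset.univ.erase k,
      (x + t • EuclideanSpace.single k (1 : ℝ) : Model n) i = x i := by
    intro t i hi; simp [Finset.ne_of_mem_erase hi]
  have hprod : ∀ t : ℝ, ∏ i ∈ Finset.univ.erase k,
      (x + t • EuclideanSpace.single k (1 : ℝ) : Model n) i ^ α i =
      ∏ i ∈ Finset.univ.erase k, x i ^ α i := fun t =>
    Finset.prod_congr rfl fun i h => by rw [hi t i h]
  simp only [mpow, ← Finset.mul_prod_erase Finset.univ _ (Finset.mem_univ k), hprod, hk,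
    monomialDeriv]
  refine HasDerivAt.div_const (HasDerivAt.mul_const ?_ _) _
  simpa using! ((hasDerivAt_id s).const_add (x k)).fun_pow (α k)

/-- Differentiation costs a factor growing linearly in the exponent; halving the radius gains
`2^{-|β|}`, which absorbs it since `β k + 1 ≤ 2^{|β|}`. -/
theorem abs_monomialDeriv_le (k : Fin n) {r : ℝ≥0} (hr : 0 < r) {x : Model n}
    (hx : ∀ i, |x i| ≤ r / 2) (α : Fin n →₀ ℕ) :
    |monomialDeriv k x α| ≤ (r : ℝ)⁻¹ * 2 * wtDiag r α := by
  by_cases hα : Finsupp.single k 1 ≤ α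
  · obtain ⟨β, rfl⟩ := exists_add_of_le hα
    rw [add_comm, monomialDeriv_add_single, abs_div, Nat.abs_cast, wtDiag, map_add,
      Finsupp.degree_single, mfact_add_single]
    have h1 : (0 : ℝ) < mfact β := by exact_mod_cast mfact_pos β
    have h3 : ((β k + 1 : ℕ) : ℝ) ≤ 2 ^ β.degree := by exact_mod_cast le_two_pow_degree β k
    have hr' : (0 : ℝ) < r := hr
    have hx' : ∀ i, |x i| ≤ (r / 2 : ℝ≥0) := fun i => by push_cast; exact hx i
    have h4 := abs_mpow_le hx' β
    push_cast at h3 h4 ⊢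
    calc |mpow (fun i => x i) β| / mfact β ≤ (r / 2 : ℝ) ^ β.degree / mfact β := by gcongr
      _ = r ^ β.degree / (2 ^ β.degree * mfact β) := by rw [div_pow, div_div]
      _ ≤ r ^ β.degree / ((β k + 1) * mfact β) := by gcongr
      _ ≤ 2 * (r ^ β.degree / ((β k + 1) * mfact β)) := by
          have : (0:ℝ) ≤ r ^ β.degree / ((β k + 1) * mfact β) := by positivity
          linarith
      _ = _ := by rw [pow_succ]; field_simp
  · have : α k = 0 := by
      by_contra h
      exact hα (by rw [Finsupp.single_le_iff]; omega)
    simp only [monomialDeriv, this]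
    simp
    positivity

theorem analyticAt_evalSeries {r : ℝ≥0} (hr : 0 < r) {a : (Fin n →₀ ℕ) → ℝ}
    (ha : wnorm (wtDiag r) a ≠ ⊤) {x : Model n} (hx : ‖x‖ < r) :
    AnalyticAt ℝ (evalSeries a) x := by
  obtain ⟨p, hp⟩ := hasFPowerSeriesOnBall_evalSeries hr ha
  exact hp.analyticAt_of_mem (by simpa using hx)

/-- The series is differentiated termwise along the line in direction `k`; the radius `r / 4` keeps
a segment of that line inside the region `|x i| ≤ r / 2` where the derivatives are dominated. The
result is identified with `pd` using the differentiability already known from analyticity. -/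
theorem pd_evalSeries {r : ℝ≥0} (hr : 0 < r) {a : (Fin n →₀ ℕ) → ℝ}
    (ha : wnorm (wtDiag r) a ≠ ⊤) (k : Fin n) {x : Model n} (hx : ‖x‖ < r / 4) :
    pd k (evalSeries a) x = evalSeries (shiftUp k a) x := by
  have hr' : (0 : ℝ) < r := hr
  set e : Model n := EuclideanSpace.single k (1 : ℝ) with he
  have hcoord : ∀ s ∈ Set.Ioo (-(r / 4 : ℝ)) (r / 4), ∀ i, |(x + s • e) i| ≤ r / 2 := by
    intro s hs i
    refine (abs_coord_le _ i).trans ((norm_add_le _ _).trans ?_)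
    have : ‖s • e‖ = |s| := by simp [he, norm_smul]
    rw [this]
    have := abs_lt.2 hs
    linarith
  have h0 : (0 : ℝ) ∈ Set.Ioo (-(r / 4 : ℝ)) (r / 4) := ⟨by linarith, by linarith⟩
  have hder : HasDerivAt (fun s : ℝ => ∑' α, seriesTerm a (x + s • e) α)
      (∑' α, a α * monomialDeriv k (x + (0 : ℝ) • e) α) 0 := by
    refine hasDerivAt_tsum_of_isPreconnected (F := ℝ) (g := fun α s => seriesTerm a (x + s • e) α)
      (g' := fun α s => a α * monomialDeriv k (x + s • e) α) (u := fun α => (r : ℝ)⁻¹ * 2 * (|a α| * wtDiag r α))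
      (t := Set.Ioo (-(r / 4 : ℝ)) (r / 4)) ((summable_wnorm ha).mul_left _) isOpen_Ioo
      isPreconnected_Ioo (fun α s hs => ?_) (fun α s hs => ?_) h0 ?_ h0
    · exact (hasDerivAt_monomial k x α s).const_mul (a α)
    · rw [norm_mul, Real.norm_eq_abs, Real.norm_eq_abs]
      calc _ ≤ |a α| * ((r : ℝ)⁻¹ * 2 * wtDiag r α) := by
            gcongr
            exact abs_monomialDeriv_le k hr (hcoord s hs) α
        _ = _ := by ring
    · refine (summable_norm_seriesTerm ha fun i => (hcoord 0 h0 i).trans ?_).of_norm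
      linarith
  have hsum : ∑' α, a α * monomialDeriv k (x + (0 : ℝ) • e) α = evalSeries (shiftUp k a) x := by
    rw [evalSeries, ← (add_single_injective k).tsum_eq]
    · refine tsum_congr fun α => ?_
      rw [monomialDeriv_add_single, zero_smul, add_zero]
      rfl
    · intro α hα
      have : Finsupp.single k 1 ≤ α := by
        rw [Finsupp.single_le_iff]
        by_contra h
        apply hα
        have : α k = 0 := by omega
        simp [monomialDeriv, this]
      exact ⟨α - Finsupp.single k 1, tsub_add_cancel_of_le this⟩
  rw [hsum] at hder
  have hd := (analyticAt_evalSeries hr ha (x := x) (by linarith)).differentiableAt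
  have hline : HasDerivAt (fun s : ℝ => x + s • e) e 0 := by
    simpa using ((hasDerivAt_id (0 : ℝ)).smul_const e).const_add x
  have hd2 := HasFDerivAt.comp_hasDerivAt (0 : ℝ) (f := fun s : ℝ => x + s • e)
    (by simpa using hd.hasFDerivAt) hline
  exact hd2.unique hder

theorem mpow_sum {R ι : Type*} [CommMonoid R] (ρ : Fin n → R) (s : Finset ι)
    (α : ι → Fin n →₀ ℕ) : mpow ρ (∑ i ∈ s, α i) = ∏ i ∈ s, mpow ρ (α i) := by
  classical
  induction s using Finset.induction_on with
  | empty => simp [mpow]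
  | insert i s hi ih => rw [Finset.sum_insert hi, Finset.prod_insert hi, mpow_add, ih]

theorem wnorm_ne_top_of_summable {κ : Type*} {w : κ → ℝ≥0} {a : κ → ℝ}
    (h : Summable fun k => |a k| * w k) : wnorm w a ≠ ⊤ := by
  have := h.tsum_ofReal_ne_top
  refine ne_of_eq_of_ne (tsum_congr fun k => ?_) this
  rw [ENNReal.ofReal_mul (abs_nonneg _), ENNReal.ofReal_coe_nnreal, ← Real.enorm_eq_ofReal_abs]

theorem wnorm_fiberwise_le {κ τ : Type*} (e : κ → τ) (w : τ → ℝ≥0) (c : κ → ℝ) :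
    wnorm w (fun t => ∑' k : e ⁻¹' {t}, c k) ≤ wnorm (fun k => w (e k)) c := by
  rw [wnorm, wnorm, ← (Equiv.sigmaFiberEquiv e).tsum_eq, ENNReal.tsum_sigma']
  refine ENNReal.tsum_le_tsum fun t => ?_
  calc ‖∑' k : e ⁻¹' {t}, c k‖ₑ * w t ≤ (∑' k : e ⁻¹' {t}, ‖c k‖ₑ) * w t := by
        gcongr
        exact enorm_tsum_le_tsum_enorm
    _ = ∑' k : e ⁻¹' {t}, ‖c k‖ₑ * w t := ENNReal.tsum_mul_right.symm
    _ = _ := tsum_congr fun ⟨k, hk⟩ => by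
        change ‖c k‖ₑ * w t = ‖c k‖ₑ * w (e k)
        rw [show e k = t from hk]

/-- Each multilinear term is expanded on words in the standard basis, and words with the same
exponent vector are collected into one monomial. -/
theorem exists_series_of_analyticAt {f : Model n → ℝ} {p : Model n} (hf : AnalyticAt ℝ f p) :
    ∃ (r : ℝ≥0) (a : (Fin n →₀ ℕ) → ℝ), 0 < r ∧ wnorm (wtDiag r) a ≠ ⊤ ∧
      ∀ x : Model n, ‖x‖ < r → HasSum (seriesTerm a x) (f (p + x)) := by
  obtain ⟨q, R, hq⟩ := hf
  obtain ⟨R₀, hR₀, hR₀R⟩ := ENNReal.lt_iff_exists_nnreal_btwn.1 hq.r_pos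
  have hR₀pos : 0 < R₀ := by simpa using hR₀
  obtain ⟨C, hC, hbound⟩ := q.norm_mul_pow_le_of_lt_radius (hR₀R.trans_le hq.r_le)
  -- There are `n ^ k` words of length `k`; dividing by `n + 1` absorbs that count and the extra `2`
  -- leaves a geometric series.
  let r : ℝ≥0 := R₀ / (2 * (n + 1))
  have hrpos : 0 < r := by positivity
  let c : (Σ k : ℕ, Fin k → Fin n) → ℝ := fun w =>
    q w.1 (fun s => EuclideanSpace.single (w.2 s) (1 : ℝ))
  let ex : (Σ k : ℕ, Fin k → Fin n) → (Fin n →₀ ℕ) := fun w =>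
    ∑ s, Finsupp.single (w.2 s) 1
  have hexdeg : ∀ w, (ex w).degree = w.1 := by
    intro w; simp [ex]
  have hmono : ∀ w (x : Model n), ∏ s, x (w.2 s) = mpow (fun i => x i) (ex w) := by
    intro w x
    simp only [ex, mpow_sum, mpow_single]
  have hcle : ∀ w, |c w| ≤ ‖q w.1‖ := by
    intro w
    refine ((q w.1).le_opNorm _).trans_eq ?_
    simp
  have hsumW : Summable fun w : (Σ k : ℕ, Fin k → Fin n) => |c w| * (r : ℝ) ^ w.1 := by
    rw [summable_sigma_of_nonneg (fun _ => by positivity)]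
    refine ⟨fun k => Summable.of_finite, ?_⟩
    refine Summable.of_nonneg_of_le (fun k => tsum_nonneg fun _ => by positivity) (fun k => ?_)
      (summable_geometric_two.mul_left C)
    rw [tsum_fintype]
    calc ∑ w : Fin k → Fin n, |c ⟨k, w⟩| * (r : ℝ) ^ k
        ≤ ∑ w : Fin k → Fin n, ‖q k‖ * (r : ℝ) ^ k := by
          gcongr with w
          exact hcle ⟨k, w⟩
      _ = (n : ℝ) ^ k * (‖q k‖ * (r : ℝ) ^ k) := by simp
      _ = (‖q k‖ * (R₀ : ℝ) ^ k) * ((n / (n + 1)) * (1 / 2) : ℝ) ^ k := by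
          simp only [r]; push_cast; rw [mul_assoc ‖q k‖, ← mul_pow, mul_left_comm, ← mul_pow]; congr 2; field_simp
      _ ≤ C * (1 / 2) ^ k := by
          gcongr
          · exact hbound k
          · have : (n : ℝ) / (n + 1) ≤ 1 := by rw [div_le_one (by positivity)]; linarith
            linarith
  let a : (Fin n →₀ ℕ) → ℝ := fun α => mfact α * ∑' w : ex ⁻¹' {α}, c w
  have hterm : ∀ x : Model n, ∀ α, seriesTerm a x α =
      ∑' w : ex ⁻¹' {α}, c w * ∏ s, x ((w : Σ k : ℕ, Fin k → Fin n).2 s) := by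
    intro x α
    have h1 : (mfact α : ℝ) ≠ 0 := by exact_mod_cast mfact_ne_zero α
    have : ∀ w : ex ⁻¹' {α}, c w * ∏ s, x ((w : Σ k : ℕ, Fin k → Fin n).2 s) =
        c w * mpow (fun i => x i) α := by
      rintro ⟨w, hw⟩
      rw [hmono, show ex w = α from hw]
    simp only [this, tsum_mul_right, seriesTerm, a]
    field_simp
  refine ⟨r, a, hrpos, ?_, fun x hx => ?_⟩
  · have ha : wnorm (wtDiag r) a = wnorm (fun α => r ^ α.degree)
        (fun α => ∑' w : ex ⁻¹' {α}, c w) := by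
      refine tsum_congr fun α => ?_
      have h1 : (mfact α : ℝ≥0) ≠ 0 := by exact_mod_cast mfact_ne_zero α
      have h2 : ‖(mfact α : ℝ)‖ₑ = ((mfact α : ℝ≥0) : ℝ≥0∞) := by
        rw [← NNReal.enorm_eq, NNReal.coe_natCast]
      rw [enorm_mul, h2, mul_comm (_ : ℝ≥0∞) ‖_‖ₑ, mul_assoc, ← ENNReal.coe_mul, wtDiag,
        mul_div_cancel₀ _ h1]
    rw [ha]
    refine ne_top_of_le_ne_top (wnorm_ne_top_of_summable ?_) (wnorm_fiberwise_le ex _ c)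
    simpa [hexdeg] using hsumW
  · have hxr : ∀ i, |x i| ≤ r := fun i => (abs_coord_le x i).trans hx.le
    have hsx : Summable fun w : (Σ k : ℕ, Fin k → Fin n) => c w * ∏ s, x (w.2 s) := by
      refine Summable.of_norm_bounded hsumW fun w => ?_
      rw [norm_mul, hmono, Real.norm_eq_abs, Real.norm_eq_abs]
      gcongr
      rw [← hexdeg w]
      exact abs_mpow_le hxr _
    have hval : ∑' w : (Σ k : ℕ, Fin k → Fin n), c w * ∏ s, x (w.2 s) = f (p + x) := by
      rw [hsx.tsum_sigma]
      have hqs := hq.hasSum (y := x) (by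
        have h1 : r ≤ R₀ := by
          simp only [r]
          refine div_le_self (zero_le) ?_
          norm_cast; omega
        refine Metric.eball_subset_eball hR₀R.le ?_
        simpa using hx.trans_le (NNReal.coe_le_coe.2 h1))
      rw [← hqs.tsum_eq]
      refine tsum_congr fun k => ?_
      rw [tsum_fintype]
      have hx' : x = ∑ i, x i • (EuclideanSpace.single i (1 : ℝ) : Model n) := by
        have := (EuclideanSpace.basisFun (Fin n) ℝ).sum_repr x
        simpa using this.symm
      conv_rhs => rw [hx']
      rw [(q k).map_sum]
      refine Finset.sum_congr rfl fun w _ => ?_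
      rw [(q k).map_smul_univ, smul_eq_mul, mul_comm]
    have := hsx.hasSum.tsum_fiberwise ex
    rw [hval] at this
    rw [funext (hterm x)]
    exact this

end Differentiation

end

/-! ### Formal solution of second-order systems with scalar principal part -/

noncomputable section

open Filter Topology
open scoped ENNReal NNReal Nat

section CauchyKovalevskaya

/-- The system is one family indexed by `ι × κ`. Each component is bounded by `θ` times the total
norm, so summing over components costs the factor `Fintype.card ι`. -/
theorem exists_fixedPoint_pi {ι κ : Type*} [Fintype ι] {w : κ → ℝ≥0} (hw : ∀ k, w k ≠ 0)
    (K : (ι → κ → ℝ) →ₗ[ℝ] (ι → κ → ℝ)) {θ : ℝ≥0} (hθ : Fintype.card ι * θ < 1)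
    (hK : ∀ u I, wnorm w (K u I) ≤ θ * ∑ J, wnorm w (u J)) {f : ι → κ → ℝ}
    (hf : ∀ I, wnorm w (f I) ≠ ⊤) :
    ∃ v : ι → κ → ℝ, (∀ I, wnorm w (v I) ≠ ⊤) ∧ v = f + K v := by
  let e := LinearEquiv.curry ℝ ℝ ι κ
  have hsum : ∀ u : ι × κ → ℝ, wnorm (fun x => w x.2) u = ∑ I, wnorm w (e u I) := by
    intro u
    rw [wnorm, ENNReal.tsum_prod', tsum_fintype]
    rfl
  obtain ⟨v, hv, hfix⟩ := exists_fixedPoint_of_wnorm_le (w := fun x : ι × κ => w x.2)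
    (fun x => hw x.2) (e.symm.toLinearMap ∘ₗ K ∘ₗ e.toLinearMap) hθ (fun u => by
      rw [hsum, hsum]
      calc ∑ I, wnorm w (e ((e.symm.toLinearMap ∘ₗ K ∘ₗ e.toLinearMap) u) I)
          = ∑ I, wnorm w (K (e u) I) := by simp
        _ ≤ ∑ _I : ι, θ * ∑ J, wnorm w (e u J) := Finset.sum_le_sum fun I _ => hK _ _
        _ = _ := by simp [mul_assoc]) (f := e.symm f) (by
      rw [hsum]
      simpa using hf)
  refine ⟨e v, fun I hI => hv ?_, ?_⟩
  · rw [hsum]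
    exact ENNReal.sum_eq_top.2 ⟨I, Finset.mem_univ _, hI⟩
  · conv_lhs => rw [hfix]
    simp

variable {n : ℕ}

theorem wtDiag_mono {r r' : ℝ≥0} (h : r ≤ r') (α : Fin n →₀ ℕ) : wtDiag r α ≤ wtDiag r' α := by
  unfold wtDiag
  gcongr

/-- Without a constant term every coefficient has degree at least one, hence gains a factor `r /
r₀`. -/
theorem wnorm_wtDiag_le_of_zero {r r₀ : ℝ≥0} (hr₀ : 0 < r₀) (h : r ≤ r₀)
    {a : (Fin n →₀ ℕ) → ℝ} (ha : a 0 = 0) :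
    wnorm (wtDiag r) a ≤ (r / r₀ : ℝ≥0) * wnorm (wtDiag r₀) a := by
  rw [wnorm, wnorm, ← ENNReal.tsum_mul_left]
  refine ENNReal.tsum_le_tsum fun α => ?_
  by_cases hα : α = 0
  · simp [hα, ha]
  rw [mul_left_comm]
  gcongr
  rw [← ENNReal.coe_mul, ENNReal.coe_le_coe, wtDiag, wtDiag, ← mul_div_assoc]
  gcongr
  obtain ⟨d, hd⟩ : ∃ d, α.degree = d + 1 := Nat.exists_eq_succ_of_ne_zero
    (by simpa [Finsupp.degree_eq_zero_iff] using hα)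
  rw [hd, pow_succ', pow_succ']
  calc r * r ^ d ≤ r * r₀ ^ d := by gcongr
    _ = r / r₀ * (r₀ * r₀ ^ d) := by field_simp

theorem leibniz_single_zero (c : ℝ) (v : (Fin n →₀ ℕ) → ℝ) :
    leibniz (Pi.single 0 c) v = c • v := by
  funext α
  have h1 : (mfact α : ℝ) ≠ 0 := by exact_mod_cast mfact_ne_zero α
  have h0 : mfact (0 : Fin n →₀ ℕ) = 1 := by simp [mfact]
  simp only [leibniz, LinearMap.coe_mk, AddHom.coe_mk, Pi.smul_apply, smul_eq_mul]
  rw [Finset.sum_eq_single (0, α)]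
  · simp [h0, h1]
  · rintro ⟨β, γ⟩ hp hne
    have hβ : β ≠ 0 := by
      rintro rfl
      apply hne
      have := Finset.HasAntidiagonal.mem_antidiagonal.1 hp
      simpa using this
    simp [hβ]
  · intro h
    exact absurd (Finset.HasAntidiagonal.mem_antidiagonal.2 (zero_add α)) h

theorem leibniz_add_left (a b v : (Fin n →₀ ℕ) → ℝ) :
    leibniz (a + b) v = leibniz a v + leibniz b v := by
  funext α
  simp only [leibniz, LinearMap.coe_mk, AddHom.coe_mk, Pi.add_apply, ← Finset.sum_add_distrib]
  exact Finset.sum_congr rfl fun p _ => by ring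

theorem shiftUp_shift (k : Fin n) (η δ : Fin n →₀ ℕ) (v : (Fin n →₀ ℕ) → ℝ) :
    shiftUp k (shift η δ v) = shift η (Finsupp.single k 1 + δ) v := by
  funext α
  simp [shiftUp, shift, add_assoc]

/-- The weights of the coordinates: the two distinguished directions carry a smaller weight. -/
def anisotropic (i j : Fin n) (r : ℝ≥0) (m : Fin n) : ℝ≥0 := if m = i ∨ m = j then r ^ 2 else r

theorem anisotropic_ne_zero (i j : Fin n) {r : ℝ≥0} (hr : 0 < r) (m : Fin n) :
    anisotropic i j r m ≠ 0 := by
  unfold anisotropic; split_ifs <;> positivity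

theorem anisotropic_le (i j : Fin n) {r : ℝ≥0} (hr1 : r ≤ 1) (m : Fin n) :
    anisotropic i j r m ≤ r := by
  unfold anisotropic; split_ifs
  · exact pow_le_of_le_one zero_le hr1 two_ne_zero
  · exact le_rfl

theorem sq_le_anisotropic (i j : Fin n) {r : ℝ≥0} (hr1 : r ≤ 1) (m : Fin n) :
    r ^ 2 ≤ anisotropic i j r m := by
  unfold anisotropic; split_ifs
  · exact le_rfl
  · exact pow_le_of_le_one zero_le hr1 two_ne_zero

theorem mpow_anisotropic (i j : Fin n) (r : ℝ≥0) :
    mpow (anisotropic i j r) (Finsupp.single i 1 + Finsupp.single j 1) = r ^ 4 := by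
  rw [mpow_add, mpow_single, mpow_single]
  simp [anisotropic]
  ring

/-- The second-order terms of the operator are small if the coefficient vanishes at
the origin or if one of the two derivatives is not in a distinguished direction. -/
theorem wnorm_second_order_le (i j : Fin n) {r r₀ : ℝ≥0} (hr : 0 < r) (hr1 : r ≤ 1) (hr₀ : r ≤ r₀)
    {a : (Fin n →₀ ℕ) → ℝ} {D : ℝ≥0} (hD : wnorm (wtDiag r₀) a ≤ D) (k l : Fin n)
    (ha : (k = i ∨ k = j) → (l = i ∨ l = j) → a 0 = 0) (v : (Fin n →₀ ℕ) → ℝ) :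
    wnorm (wt (anisotropic i j r)) (leibniz a (shift (Finsupp.single i 1 + Finsupp.single j 1)
      (Finsupp.single k 1 + Finsupp.single l 1) v)) ≤
      (r * (D * (1 + r₀⁻¹)) : ℝ≥0) * wnorm (wt (anisotropic i j r)) v := by
  have hr₀pos : 0 < r₀ := hr.trans_le hr₀
  refine (wnorm_leibniz_le _ _ _).trans ?_
  refine (mul_le_mul' le_rfl (wnorm_shift_le (anisotropic_ne_zero i j hr) (by simp) v)).trans ?_
  rw [← mul_assoc, mpow_anisotropic, mpow_add, mpow_single, mpow_single]
  gcongr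
  have ha1 : wnorm (wt (anisotropic i j r)) a ≤ wnorm (wtDiag r) a :=
    wnorm_mono (wt_le_wtDiag (anisotropic_le i j hr1)) a
  have ha2 : wnorm (wtDiag r) a ≤ D := (wnorm_mono (wtDiag_mono hr₀) a).trans hD
  by_cases hkl : (k = i ∨ k = j) ∧ (l = i ∨ l = j)
  · have hratio : r ^ 4 / (anisotropic i j r k * anisotropic i j r l) = 1 := by
      rw [anisotropic, anisotropic, if_pos hkl.1, if_pos hkl.2]
      field_simp
    rw [hratio]
    calc _ ≤ ((r / r₀ : ℝ≥0) * wnorm (wtDiag r₀) a) * (1 : ℝ≥0) := by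
          gcongr
          exact ha1.trans (wnorm_wtDiag_le_of_zero hr₀pos hr₀ (ha hkl.1 hkl.2))
      _ ≤ ((r / r₀ : ℝ≥0) * (D : ℝ≥0∞)) * (1 : ℝ≥0) := by gcongr
      _ = ((r * (D * r₀⁻¹) : ℝ≥0) : ℝ≥0∞) := by
          rw [← ENNReal.coe_mul, ← ENNReal.coe_mul]; congr 1; rw [div_eq_mul_inv]; ring
      _ ≤ _ := by
          gcongr
          exact le_add_self
  · have hratio : r ^ 4 / (anisotropic i j r k * anisotropic i j r l) ≤ r := by
      have hpos : ∀ m, 0 < anisotropic i j r m := fun m =>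
        pos_iff_ne_zero.2 (anisotropic_ne_zero i j hr m)
      rw [div_le_iff₀ (mul_pos (hpos k) (hpos l))]
      have h3 : r ^ 3 ≤ anisotropic i j r k * anisotropic i j r l := by
        rcases not_and_or.1 hkl with h | h
        · have : anisotropic i j r k = r := if_neg h
          rw [this, pow_succ']
          gcongr
          exact sq_le_anisotropic i j hr1 l
        · have : anisotropic i j r l = r := if_neg h
          rw [this, pow_succ]
          gcongr
          exact sq_le_anisotropic i j hr1 k
      calc r ^ 4 = r * r ^ 3 := by ring
        _ ≤ _ := by gcongr
    calc _ ≤ (D : ℝ≥0∞) * (r : ℝ≥0) := by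
          gcongr
          exact ha1.trans ha2
      _ = ((r * (D * 1) : ℝ≥0) : ℝ≥0∞) := by rw [← ENNReal.coe_mul]; congr 1; ring
      _ ≤ _ := by
          gcongr
          exact le_self_add

theorem wnorm_first_order_le (i j : Fin n) {r r₀ : ℝ≥0} (hr : 0 < r) (hr1 : r ≤ 1) (hr₀ : r ≤ r₀)
    {a : (Fin n →₀ ℕ) → ℝ} {D : ℝ≥0} (hD : wnorm (wtDiag r₀) a ≤ D) (k : Fin n)
    (v : (Fin n →₀ ℕ) → ℝ) :
    wnorm (wt (anisotropic i j r)) (leibniz a (shift (Finsupp.single i 1 + Finsupp.single j 1)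
      (Finsupp.single k 1) v)) ≤
      (r * (D * (1 + r₀⁻¹)) : ℝ≥0) * wnorm (wt (anisotropic i j r)) v := by
  refine (wnorm_leibniz_le _ _ _).trans ?_
  refine (mul_le_mul' le_rfl (wnorm_shift_le (anisotropic_ne_zero i j hr) (by simp) v)).trans ?_
  rw [← mul_assoc, mpow_anisotropic, mpow_single]
  gcongr
  have ha : wnorm (wt (anisotropic i j r)) a ≤ D :=
    (wnorm_mono (fun α => (wt_le_wtDiag (anisotropic_le i j hr1) α).trans (wtDiag_mono hr₀ α))
      a).trans hD
  have hratio : r ^ 4 / anisotropic i j r k ≤ r := by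
    rw [div_le_iff₀ (pos_iff_ne_zero.2 (anisotropic_ne_zero i j hr k))]
    calc r ^ 4 = (r * r) * r ^ 2 := by ring
      _ ≤ (r * 1) * anisotropic i j r k := by
          gcongr
          exact sq_le_anisotropic i j hr1 k
      _ = _ := by rw [mul_one]
  calc _ ≤ (D : ℝ≥0∞) * (r : ℝ≥0) := by gcongr
    _ = ((r * (D * 1) : ℝ≥0) : ℝ≥0∞) := by rw [← ENNReal.coe_mul]; congr 1; ring
    _ ≤ _ := by
        gcongr
        exact le_self_add

/-- Formal solvability, with convergence, of a second-order linear system with scalar principal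
part. -/
theorem exists_formal_solution {ι : Type*} [Fintype ι] {r₀ : ℝ≥0} (hr₀ : 0 < r₀)
    (G : Fin n → Fin n → (Fin n →₀ ℕ) → ℝ) (hG : ∀ k l, wnorm (wtDiag r₀) (G k l) ≠ ⊤)
    (hsymm : ∀ k l, G k l 0 = G l k 0) (hne : ∃ k l, G k l 0 ≠ 0)
    (B : ι → ι → Fin n → (Fin n →₀ ℕ) → ℝ) (hB : ∀ I J k, wnorm (wtDiag r₀) (B I J k) ≠ ⊤)
    (f : ι → (Fin n →₀ ℕ) → ℝ) (hf : ∀ I, wnorm (wtDiag r₀) (f I) ≠ ⊤) :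
    ∃ (r : ℝ≥0) (η : Fin n →₀ ℕ) (v : ι → (Fin n →₀ ℕ) → ℝ), 0 < r ∧ r ≤ r₀ ∧
      (∀ I δ, δ.degree ≤ 2 → wnorm (wtDiag r) (shift η δ (v I)) ≠ ⊤) ∧
      ∀ I, ∑ k, ∑ l, leibniz (G k l)
          (shift η (Finsupp.single k 1 + Finsupp.single l 1) (v I))
        + ∑ J, ∑ k, leibniz (B I J k) (shift η (Finsupp.single k 1) (v J)) = f I := by
  classical
  -- A nonzero diagonal entry is preferred, so that in the case `i ≠ j` both diagonal entries in the
  -- distinguished plane vanish at the origin and need no cancelling.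
  obtain ⟨i, j, hij, hdiag⟩ : ∃ i j, G i j 0 ≠ 0 ∧ (i ≠ j → G i i 0 = 0 ∧ G j j 0 = 0) := by
    by_cases h : ∃ i, G i i 0 ≠ 0
    · obtain ⟨i, hi⟩ := h
      exact ⟨i, i, hi, fun h => absurd rfl h⟩
    · push Not at h
      obtain ⟨i, j, hij⟩ := hne
      exact ⟨i, j, hij, fun _ => ⟨h i, h j⟩⟩
  set η : Fin n →₀ ℕ := Finsupp.single i 1 + Finsupp.single j 1 with hη
  -- The frozen part of the operator: the entries whose derivative is exactly `∂^η`. Their sum `c`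
  -- is `G i i 0` if `i = j` and `2 * G i j 0` otherwise. The remainder `H` vanishes at the origin
  -- on the distinguished block.
  let C : Fin n → Fin n → ℝ := fun k l =>
    if (k = i ∧ l = j) ∨ (k = j ∧ l = i) then G i j 0 else 0
  let c : ℝ := ∑ k, ∑ l, C k l
  have hc : c ≠ 0 := by
    by_cases h : i = j
    · subst h
      have : c = G i i 0 := by
        simp only [c, C, or_self]
        rw [Finset.sum_eq_single i (fun k _ hk => by simp [hk]) (by simp)]
        simp
      rwa [this]
    · have : c = 2 * G i j 0 := by
        have hC : ∀ k l, C k l = (if k = i then (if l = j then G i j 0 else 0) else 0)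
            + (if k = j then (if l = i then G i j 0 else 0) else 0) := by
          intro k l
          by_cases h1 : k = i
          · subst h1
            simp [C, h]
          · simp [C, h1]
            split_ifs <;> simp_all
        simp only [c, hC, Finset.sum_add_distrib]
        simp
        ring
      rw [this]
      exact mul_ne_zero two_ne_zero hij
  let H : Fin n → Fin n → (Fin n →₀ ℕ) → ℝ := fun k l => G k l - Pi.single 0 (C k l)
  have hH0 : ∀ k l, (k = i ∨ k = j) → (l = i ∨ l = j) → H k l 0 = 0 := by
    intro k l hk hl
    simp only [H, Pi.sub_apply, Pi.single_eq_same, C]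
    by_cases h : i = j
    · subst h
      simp_all
    · obtain ⟨h1, h2⟩ := hdiag h
      rcases hk with rfl | rfl <;> rcases hl with rfl | rfl <;> simp_all
  have hH : ∀ k l, wnorm (wtDiag r₀) (H k l) ≠ ⊤ := by
    intro k l
    refine ne_top_of_le_ne_top (ENNReal.add_ne_top.2 ⟨hG k l, ?_⟩) (wnorm_sub_le _ _ _)
    rw [wnorm, tsum_eq_single 0 (fun α hα => by simp [hα])]
    exact ENNReal.mul_ne_top (by simp) (by simp)
  obtain ⟨D, hDH, hDB⟩ : ∃ D : ℝ≥0, (∀ k l, wnorm (wtDiag r₀) (H k l) ≤ D) ∧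
      ∀ I J k, wnorm (wtDiag r₀) (B I J k) ≤ D := by
    let S : ℝ≥0∞ := (∑ x : Fin n × Fin n, wnorm (wtDiag r₀) (H x.1 x.2))
      + ∑ x : ι × ι × Fin n, wnorm (wtDiag r₀) (B x.1 x.2.1 x.2.2)
    have hS : S ≠ ⊤ := ENNReal.add_ne_top.2 ⟨ENNReal.sum_ne_top.2 fun x _ => hH _ _,
      ENNReal.sum_ne_top.2 fun x _ => hB _ _ _⟩
    refine ⟨S.toNNReal, fun k l => ?_, fun I J k => ?_⟩ <;> rw [ENNReal.coe_toNNReal hS]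
    · exact (Finset.single_le_sum (f := fun x : Fin n × Fin n => wnorm (wtDiag r₀) (H x.1 x.2))
        (fun _ _ => zero_le) (Finset.mem_univ (k, l))).trans le_self_add
    · exact (Finset.single_le_sum (f := fun x : ι × ι × Fin n =>
        wnorm (wtDiag r₀) (B x.1 x.2.1 x.2.2)) (fun _ _ => zero_le)
        (Finset.mem_univ (I, J, k))).trans le_add_self
  let D' : ℝ≥0 := D * (1 + r₀⁻¹)
  let A : ℝ≥0 := ‖c⁻¹‖₊ * ((n * n + n) * D')
  obtain ⟨r, hr, hr1, hrr₀, hrA⟩ : ∃ r : ℝ≥0, 0 < r ∧ r ≤ 1 ∧ r ≤ r₀ ∧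
      Fintype.card ι * (r * A) < 1 := by
    refine ⟨min (min 1 r₀) (1 / (Fintype.card ι * A + 1)), by positivity,
      (min_le_left _ _).trans (min_le_left _ _), (min_le_left _ _).trans (min_le_right _ _), ?_⟩
    calc Fintype.card ι * (min (min 1 r₀) (1 / (Fintype.card ι * A + 1)) * A)
        ≤ Fintype.card ι * (1 / (Fintype.card ι * A + 1) * A) := by
          gcongr; exact min_le_right _ _
      _ = (Fintype.card ι * A) / (Fintype.card ι * A + 1) := by ring
      _ < 1 := by
          rw [div_lt_one (by positivity)]
          exact lt_add_one _
  set ρ := anisotropic i j r with hρ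
  -- Since `∂^η∂^{-η}` is the identity, the frozen part acts as multiplication by `c`, and dividing
  -- by `c` gives the fixed-point equation `v = c⁻¹ f + K v`.
  let K : (ι → (Fin n →₀ ℕ) → ℝ) →ₗ[ℝ] (ι → (Fin n →₀ ℕ) → ℝ) := LinearMap.pi fun I =>
    (-c⁻¹) • ((∑ k, ∑ l, leibniz (H k l) ∘ₗ
        shift η (Finsupp.single k 1 + Finsupp.single l 1) ∘ₗ LinearMap.proj I)
      + ∑ J, ∑ k, leibniz (B I J k) ∘ₗ shift η (Finsupp.single k 1) ∘ₗ LinearMap.proj J)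
  have hKapply : ∀ u I, K u I = (-c⁻¹) • ((∑ k, ∑ l, leibniz (H k l)
        (shift η (Finsupp.single k 1 + Finsupp.single l 1) (u I)))
      + ∑ J, ∑ k, leibniz (B I J k) (shift η (Finsupp.single k 1) (u J))) := by
    intro u I
    simp [K]
  have hK : ∀ u I, wnorm (wt ρ) (K u I) ≤ (r * A : ℝ≥0) * ∑ J, wnorm (wt ρ) (u J) := by
    intro u I
    have h1 : wnorm (wt ρ) (∑ k, ∑ l, leibniz (H k l)
        (shift η (Finsupp.single k 1 + Finsupp.single l 1) (u I))) ≤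
        (n * n * (r * D') : ℝ≥0) * ∑ J, wnorm (wt ρ) (u J) := by
      calc _ ≤ ∑ k, ∑ l, wnorm (wt ρ) (leibniz (H k l)
            (shift η (Finsupp.single k 1 + Finsupp.single l 1) (u I))) :=
            (wnorm_sum_le _ _ _).trans (Finset.sum_le_sum fun k _ => wnorm_sum_le _ _ _)
        _ ≤ ∑ k : Fin n, ∑ l : Fin n, (r * D' : ℝ≥0) * ∑ J, wnorm (wt ρ) (u J) := by
            gcongr with k _ l _
            refine (wnorm_second_order_le i j hr hr1 hrr₀ (hDH k l) k l (hH0 k l) (u I)).trans ?_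
            gcongr
            exact Finset.single_le_sum (f := fun J => wnorm (wt ρ) (u J)) (fun _ _ => zero_le)
              (Finset.mem_univ I)
        _ = _ := by
            simp only [Finset.sum_const, Finset.card_univ, Fintype.card_fin, nsmul_eq_mul]
            push_cast; ring
    have h2 : wnorm (wt ρ) (∑ J, ∑ k, leibniz (B I J k) (shift η (Finsupp.single k 1) (u J))) ≤
        (n * (r * D') : ℝ≥0) * ∑ J, wnorm (wt ρ) (u J) := by
      calc _ ≤ ∑ J, ∑ k, wnorm (wt ρ) (leibniz (B I J k) (shift η (Finsupp.single k 1) (u J))) :=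
            (wnorm_sum_le _ _ _).trans (Finset.sum_le_sum fun k _ => wnorm_sum_le _ _ _)
        _ ≤ ∑ J, ∑ k : Fin n, (r * D' : ℝ≥0) * wnorm (wt ρ) (u J) := by
            gcongr with J _ k _
            exact wnorm_first_order_le i j hr hr1 hrr₀ (hDB I J k) k (u J)
        _ = _ := by
            simp only [Finset.sum_const, Finset.card_univ, Fintype.card_fin, nsmul_eq_mul,
              Finset.mul_sum]
            push_cast
            exact Finset.sum_congr rfl fun J _ => by ring
    rw [hKapply, wnorm_smul, enorm_neg]
    calc _ ≤ ‖c⁻¹‖ₑ * ((n * n * (r * D') : ℝ≥0) * ∑ J, wnorm (wt ρ) (u J)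
          + (n * (r * D') : ℝ≥0) * ∑ J, wnorm (wt ρ) (u J)) := by
          gcongr
          exact (wnorm_add_le _ _ _).trans (add_le_add h1 h2)
      _ = _ := by
          simp only [A, enorm_eq_nnnorm]
          push_cast; ring
  have hρne := anisotropic_ne_zero i j hr
  obtain ⟨v, hv, hfix⟩ := exists_fixedPoint_pi (wt_ne_zero hρne) K hrA hK
    (f := fun I => c⁻¹ • f I) (fun I => by
      rw [wnorm_smul]
      refine ENNReal.mul_ne_top (by simp) (ne_top_of_le_ne_top (hf I) (wnorm_mono (fun α => ?_) _))
      exact wt_le_wtDiag (fun m => (anisotropic_le i j hr1 m).trans hrr₀) α)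
  -- The smallest anisotropic weight is at least `r ^ 2`; the `2 ^ n` is the price of passing from
  -- `|α|!` to `α!`.
  refine ⟨r ^ 2 / 2 ^ n, η, v, by positivity, ?_, ?_, ?_⟩
  · refine (div_le_self zero_le ?_).trans ((pow_le_of_le_one zero_le hr1 two_ne_zero).trans hrr₀)
    exact_mod_cast Nat.one_le_two_pow
  · intro I δ hδ
    refine ne_top_of_le_ne_top ?_ (wnorm_mono (wtDiag_le_wt (ρ := ρ) fun m => ?_) _)
    · refine ne_top_of_le_ne_top (ENNReal.mul_ne_top ENNReal.coe_ne_top (hv I))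
        (wnorm_shift_le hρne ?_ (v I))
      simpa [hη] using hδ
    · rw [div_mul_cancel₀ _ (by positivity)]
      exact sq_le_anisotropic i j hr1 m
  · intro I
    have h1 : ∑ k, ∑ l, leibniz (G k l)
          (shift η (Finsupp.single k 1 + Finsupp.single l 1) (v I)) =
        (∑ k, ∑ l, leibniz (H k l)
          (shift η (Finsupp.single k 1 + Finsupp.single l 1) (v I))) + c • v I := by
      have hGH : ∀ k l, leibniz (G k l)
          (shift η (Finsupp.single k 1 + Finsupp.single l 1) (v I)) = leibniz (H k l)
          (shift η (Finsupp.single k 1 + Finsupp.single l 1) (v I)) + C k l • v I := by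
        intro k l
        have hsplit : G k l = H k l + Pi.single 0 (C k l) := by simp [H]
        conv_lhs => rw [hsplit]
        rw [leibniz_add_left, leibniz_single_zero]
        congr 1
        by_cases hkl : (k = i ∧ l = j) ∨ (k = j ∧ l = i)
        · have : Finsupp.single k 1 + Finsupp.single l 1 = η := by
            rcases hkl with ⟨rfl, rfl⟩ | ⟨rfl, rfl⟩
            · rfl
            · rw [hη, add_comm]
          rw [this, shift_self]
        · simp [C, hkl]
      simp only [hGH, Finset.sum_add_distrib, c, Finset.sum_smul]
    have h2 := congrFun hfix I
    simp only [Pi.add_apply, hKapply] at h2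
    have h3 : c • v I = f I - ((∑ k, ∑ l, leibniz (H k l)
        (shift η (Finsupp.single k 1 + Finsupp.single l 1) (v I)))
      + ∑ J, ∑ k, leibniz (B I J k) (shift η (Finsupp.single k 1) (v J))) := by
      conv_lhs => rw [h2]
      rw [smul_add, smul_smul, smul_smul, mul_inv_cancel₀ hc, mul_neg, mul_inv_cancel₀ hc]
      rw [one_smul, neg_smul, one_smul, ← sub_eq_add_neg]
    rw [h1, h3]
    abel

end CauchyKovalevskaya

end

/-! ### Local analytic solvability -/

noncomputable section

open Filter Topology
open scoped ENNReal NNReal Nat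

section LocalSolvability

variable {n : ℕ}

theorem seriesTerm_zero (a : (Fin n →₀ ℕ) → ℝ) : HasSum (seriesTerm a (0 : Model n)) (a 0) := by
  have h : a 0 = seriesTerm a 0 0 := by simp [seriesTerm, mpow, mfact]
  rw [h]
  refine hasSum_single 0 fun α hα => ?_
  obtain ⟨i, hi⟩ := Finsupp.ne_iff.1 hα
  have : mpow (fun i => (0 : Model n) i) α = 0 :=
    Finset.prod_eq_zero (Finset.mem_univ i) (by simpa using hi)
  rw [seriesTerm, this, zero_div, mul_zero]

theorem seriesTerm_add (a b : (Fin n →₀ ℕ) → ℝ) (x : Model n) (α : Fin n →₀ ℕ) :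
    seriesTerm (a + b) x α = seriesTerm a x α + seriesTerm b x α := by
  simp [seriesTerm, add_mul]

theorem seriesTerm_sum {ι : Type*} (s : Finset ι) (a : ι → (Fin n →₀ ℕ) → ℝ) (x : Model n)
    (α : Fin n →₀ ℕ) : seriesTerm (∑ i ∈ s, a i) x α = ∑ i ∈ s, seriesTerm (a i) x α := by
  simp [seriesTerm, Finset.sum_mul]

/-- A finite family of analytic functions is represented by power series with a common radius. -/
theorem exists_series_family {τ : Type*} [Fintype τ] {f : τ → Model n → ℝ} {p : Model n}
    (hf : ∀ t, AnalyticAt ℝ (f t) p) :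
    ∃ (r : ℝ≥0) (a : τ → (Fin n →₀ ℕ) → ℝ), 0 < r ∧ (∀ t, wnorm (wtDiag r) (a t) ≠ ⊤) ∧
      ∀ t (x : Model n), ‖x‖ < r → HasSum (seriesTerm (a t) x) (f t (p + x)) := by
  choose r a hr ha hs using fun t => exists_series_of_analyticAt (hf t)
  obtain ⟨R, hR, hRr⟩ : ∃ R : ℝ≥0, 0 < R ∧ ∀ t, R ≤ r t := by
    rcases isEmpty_or_nonempty τ with h | h
    · exact ⟨1, one_pos, fun t => h.elim t⟩
    · obtain ⟨t₀, ht₀⟩ := Finite.exists_min r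
      exact ⟨r t₀, hr t₀, ht₀⟩
  exact ⟨R, a, hR, fun t => ne_top_of_le_ne_top (ha t) (wnorm_mono (wtDiag_mono (hRr t)) _),
    fun t x hx => hs t x (hx.trans_le (by exact_mod_cast hRr t))⟩

theorem pd_comp_sub (k : Fin n) (f : Model n → ℝ) (p u : Model n) :
    pd k (fun w => f (w - p)) u = pd k f (u - p) := by
  simp only [pd, fderiv_comp_sub]

/-- Local analytic solvability of second-order linear systems with scalar nonvanishing principal
part. -/
theorem exists_analytic_solution {ι : Type*} [Fintype ι] (p : Model n)
    (G : Fin n → Fin n → Model n → ℝ) (hG : ∀ k l, AnalyticAt ℝ (G k l) p)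
    (hsymm : ∀ k l, G k l p = G l k p) (hne : ∃ k l, G k l p ≠ 0)
    (B : ι → ι → Fin n → Model n → ℝ) (hB : ∀ I J k, AnalyticAt ℝ (B I J k) p)
    (f : ι → Model n → ℝ) (hf : ∀ I, AnalyticAt ℝ (f I) p) :
    ∃ s : ι → Model n → ℝ, (∀ I, AnalyticAt ℝ (s I) p) ∧ ∀ᶠ u in 𝓝 p, ∀ I,
      (∑ k, ∑ l, G k l u * pd k (pd l (s I)) u) + ∑ J, ∑ k, B I J k u * pd k (s J) u = f I u := by
  obtain ⟨r₁, a₁, hr₁, ha₁, hs₁⟩ := exists_series_family (τ := Fin n × Fin n)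
    (f := fun t => G t.1 t.2) fun t => hG _ _
  obtain ⟨r₂, a₂, hr₂, ha₂, hs₂⟩ := exists_series_family (τ := ι × ι × Fin n)
    (f := fun t => B t.1 t.2.1 t.2.2) fun t => hB _ _ _
  obtain ⟨r₃, a₃, hr₃, ha₃, hs₃⟩ := exists_series_family hf
  let r₀ := min r₁ (min r₂ r₃)
  have hr₀ : 0 < r₀ := lt_min hr₁ (lt_min hr₂ hr₃)
  have h01 : r₀ ≤ r₁ := min_le_left _ _
  have h02 : r₀ ≤ r₂ := (min_le_right _ _).trans (min_le_left _ _)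
  have h03 : r₀ ≤ r₃ := (min_le_right _ _).trans (min_le_right _ _)
  have hval : ∀ k l, a₁ (k, l) 0 = G k l p := by
    intro k l
    have h1 := hs₁ (k, l) 0 (by simpa using hr₁)
    rw [add_zero] at h1
    exact (seriesTerm_zero _).unique h1
  obtain ⟨r, η, v, hr, hrr₀, hv, heq⟩ := exists_formal_solution hr₀ (fun k l => a₁ (k, l))
    (fun k l => ne_top_of_le_ne_top (ha₁ (k, l)) (wnorm_mono (wtDiag_mono h01) _))
    (fun k l => by rw [hval, hval, hsymm])
    (by simpa only [hval] using hne) (fun I J k => a₂ (I, J, k))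
    (fun I J k => ne_top_of_le_ne_top (ha₂ (I, J, k)) (wnorm_mono (wtDiag_mono h02) _)) a₃
    (fun I => ne_top_of_le_ne_top (ha₃ I) (wnorm_mono (wtDiag_mono h03) _))
  have hr' : (0 : ℝ) < r := hr
  -- The fixed point `v` stands for `∂^η s`, so the solution is its iterated integral, recentred at
  -- `p`.
  let s : ι → Model n → ℝ := fun I u => evalSeries (shift η 0 (v I)) (u - p)
  have hball : ∀ᶠ u in 𝓝 p, ‖u - p‖ < r / 4 := by
    filter_upwards [Metric.ball_mem_nhds p (show (0 : ℝ) < r / 4 by positivity)] with u hu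
    simpa [dist_eq_norm] using hu
  have hpd : ∀ I δ k, δ.degree ≤ 1 → ∀ u, ‖u - p‖ < r / 4 →
      pd k (fun w => evalSeries (shift η δ (v I)) (w - p)) u =
        evalSeries (shift η (Finsupp.single k 1 + δ) (v I)) (u - p) := by
    intro I δ k hδ u hu
    rw [pd_comp_sub, pd_evalSeries hr (hv I δ (by omega)) k hu, shiftUp_shift]
  refine ⟨s, fun I => ?_, ?_⟩
  · have h1 := analyticAt_evalSeries hr (hv I 0 (by simp)) (x := p - p) (by simpa using hr)
    exact h1.comp (f := fun u : Model n => u - p) (analyticAt_id.sub analyticAt_const)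
  · filter_upwards [hball.eventually_nhds] with u hu I
    have hu0 : ‖u - p‖ < r / 4 := hu.self_of_nhds
    have hur : ‖u - p‖ < r := by linarith
    have hc : ∀ i, |(u - p) i| ≤ r := fun i => (abs_coord_le _ i).trans hur.le
    have h1 : ∀ J k, pd k (s J) u = evalSeries (shift η (Finsupp.single k 1) (v J)) (u - p) := by
      intro J k
      simpa using hpd J 0 k (by simp) u hu0
    have h2 : ∀ J k l, pd k (pd l (s J)) u =
        evalSeries (shift η (Finsupp.single k 1 + Finsupp.single l 1) (v J)) (u - p) := by
      intro J k l
      rw [← hpd J _ k (by simp) u hu0]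
      refine pd_congr k ?_
      filter_upwards [hu] with w hw
      simpa using hpd J 0 l (by simp) w hw
    have hrle : ∀ {r' : ℝ≥0}, r₀ ≤ r' → ‖u - p‖ < r' := fun h =>
      hur.trans_le (by exact_mod_cast hrr₀.trans h)
    have hup : p + (u - p) = u := by abel
    have hsum : ∀ J δ, δ.degree ≤ 2 → HasSum (seriesTerm (shift η δ (v J)) (u - p))
        (evalSeries (shift η δ (v J)) (u - p)) := fun J δ hδ => hasSum_evalSeries (hv J δ hδ) hc
    have t1 : HasSum (seriesTerm (∑ k, ∑ l, leibniz (a₁ (k, l))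
        (shift η (Finsupp.single k 1 + Finsupp.single l 1) (v I))) (u - p))
        (∑ k, ∑ l, G k l u * pd k (pd l (s I)) u) := by
      rw [funext (seriesTerm_sum _ _ _)]
      refine hasSum_sum fun k _ => ?_
      rw [funext (seriesTerm_sum _ _ _)]
      refine hasSum_sum fun l _ => ?_
      rw [h2]
      have hg := hs₁ (k, l) (u - p) (hrle h01)
      rw [hup] at hg
      exact seriesTerm_leibniz_hasSum
        (ne_top_of_le_ne_top (ha₁ (k, l)) (wnorm_mono (wtDiag_mono (hrr₀.trans h01)) _))
        (hv I _ (by simp)) hc hg (hsum I _ (by simp))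
    have t2 : HasSum (seriesTerm (∑ J, ∑ k, leibniz (a₂ (I, J, k))
        (shift η (Finsupp.single k 1) (v J))) (u - p))
        (∑ J, ∑ k, B I J k u * pd k (s J) u) := by
      rw [funext (seriesTerm_sum _ _ _)]
      refine hasSum_sum fun J _ => ?_
      rw [funext (seriesTerm_sum _ _ _)]
      refine hasSum_sum fun k _ => ?_
      rw [h1]
      have hg := hs₂ (I, J, k) (u - p) (hrle h02)
      rw [hup] at hg
      exact seriesTerm_leibniz_hasSum
        (ne_top_of_le_ne_top (ha₂ (I, J, k)) (wnorm_mono (wtDiag_mono (hrr₀.trans h02)) _))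
        (hv J _ (by simp)) hc hg (hsum J _ (by simp))
    have t3 := t1.add t2
    have hf3 := hs₃ I (u - p) (hrle h03)
    rw [hup, ← heq I, funext (seriesTerm_add _ _ _)] at hf3
    exact t3.unique hf3

end LocalSolvability

end

/-! ### The ansatz and existence of Ricci potentials -/

noncomputable section

open Filter Topology

section RicciPotential

variable {n : ℕ} {M : Type*} [TopologicalSpace M] [ChartedSpace (Model n) M]

/-- The entry `D_{cdf}` as a linear form on arrays. -/
def arrayEntry (c d f : Fin n) : (Fin n → Fin n → Fin n → ℝ) →ₗ[ℝ] ℝ :=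
  LinearMap.proj f ∘ₗ LinearMap.proj d ∘ₗ LinearMap.proj c

theorem arrayEntry_apply (c d f : Fin n) (D : Fin n → Fin n → Fin n → ℝ) :
    arrayEntry c d f D = D c d f := rfl

/-- The first-order part of `Y_{abe}^{;e} + Z_{a;b}` for `Y_{abe} = ∂ₑσ_{ab} - ∂_bσ_{ae}` and
`Z_a = g^{ef}∂_fσ_{ae}`, as a linear form in the array `D_{abf} = ∂_fσ_{ab}`. -/
def lowerForm (g : AnalyticMetric n M) (φ : OpenPartialHomeomorph M (Model n)) (u : Model n)
    (a b : Fin n) : (Fin n → Fin n → Fin n → ℝ) →ₗ[ℝ] ℝ :=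
  (∑ e, ∑ f, pd b (fun w => gUp g φ w e f) u • arrayEntry a e f)
    - (∑ e, ∑ f, gUp g φ u e f •
        ((∑ m, christoffel g φ u m f a • (arrayEntry m b e - arrayEntry m e b))
          + (∑ m, christoffel g φ u m f b • (arrayEntry a m e - arrayEntry a e m))
          + ∑ m, christoffel g φ u m f e • (arrayEntry a b m - arrayEntry a m b)))
    - ∑ m, christoffel g φ u m b a • ∑ e, ∑ f, gUp g φ u e f • arrayEntry m e f

theorem lowerForm_apply (g : AnalyticMetric n M) (φ : OpenPartialHomeomorph M (Model n))
    (u : Model n) (a b : Fin n) (D : Fin n → Fin n → Fin n → ℝ) :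
    lowerForm g φ u a b D =
      (∑ e, ∑ f, pd b (fun w => gUp g φ w e f) u * D a e f)
      - (∑ e, ∑ f, gUp g φ u e f *
          ((∑ m, christoffel g φ u m f a * (D m b e - D m e b))
            + (∑ m, christoffel g φ u m f b * (D a m e - D a e m))
            + ∑ m, christoffel g φ u m f e * (D a b m - D a m b)))
      - ∑ m, christoffel g φ u m b a * ∑ e, ∑ f, gUp g φ u e f * D m e f := by
  simp [lowerForm, arrayEntry_apply, mul_add]

/-- Symmetrization of an array in its first two indices. -/
def symmetrizeArray : (Fin n → Fin n → Fin n → ℝ) →ₗ[ℝ] (Fin n → Fin n → Fin n → ℝ) where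
  toFun D c d f := (1 / 2) * (D c d f + D d c f)
  map_add' D D' := by funext c d f; simp only [Pi.add_apply]; ring
  map_smul' r D := by funext c d f; simp only [Pi.smul_apply, RingHom.id_apply, smul_eq_mul]; ring

/-- Reads off the scalar coefficients of a linear form in the gradient, the format in which
`exists_analytic_solution` expects first-order terms. -/
theorem sum_single_array (T : (Fin n → Fin n → Fin n → ℝ) →ₗ[ℝ] ℝ)
    (D : Fin n → Fin n → Fin n → ℝ) :
    ∑ x : Fin n × Fin n, ∑ f, T (Pi.single x.1 (Pi.single x.2 (Pi.single f 1))) * D x.1 x.2 f =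
      T D := by
  have : D = ∑ x : Fin n × Fin n, ∑ f,
      D x.1 x.2 f • Pi.single x.1 (Pi.single x.2 (Pi.single f (1 : ℝ))) := by
    funext c d f
    rw [Fintype.sum_prod_type]
    simp only [Finset.sum_apply, Pi.smul_apply, smul_eq_mul]
    rw [Finset.sum_eq_single c (fun c' _ h => by simp [h.symm]) (by simp),
      Finset.sum_eq_single d (fun d' _ h => by simp [h.symm]) (by simp),
      Finset.sum_eq_single f (fun f' _ h => by simp [h.symm]) (by simp)]
    simp
  conv_rhs => rw [this]
  simp [mul_comm]

variable {φ : OpenPartialHomeomorph M (Model n)} (hφ : φ ∈ IsManifold.maximalAtlas (𝓡 n) ω M)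
  (g : AnalyticMetric n M)
include hφ

theorem analyticAt_lowerForm {x : M} (hx : x ∈ φ.source) (a b : Fin n)
    (D : Fin n → Fin n → Fin n → ℝ) : AnalyticAt ℝ (fun u => lowerForm g φ u a b D) (φ x) := by
  have h1 := fun i j => analyticAt_gUp hφ g hx i j
  have h2 := fun m i j => analyticAt_christoffel hφ g hx m i j
  have h3 := fun k i j => (analyticAt_gUp hφ g hx i j).pd k
  simp only [lowerForm_apply]
  refine ((Finset.analyticAt_fun_sum _ fun e _ => Finset.analyticAt_fun_sum _ fun f _ =>
    (h3 b e f).mul analyticAt_const).sub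
    (Finset.analyticAt_fun_sum _ fun e _ => Finset.analyticAt_fun_sum _ fun f _ =>
      (h1 e f).mul ?_)).sub
    (Finset.analyticAt_fun_sum _ fun m _ => (h2 m b a).mul
      (Finset.analyticAt_fun_sum _ fun e _ => Finset.analyticAt_fun_sum _ fun f _ =>
        (h1 e f).mul analyticAt_const))
  exact ((Finset.analyticAt_fun_sum _ fun m _ => (h2 _ _ _).mul analyticAt_const).add
    (Finset.analyticAt_fun_sum _ fun m _ => (h2 _ _ _).mul analyticAt_const)).add
    (Finset.analyticAt_fun_sum _ fun m _ => (h2 _ _ _).mul analyticAt_const)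

theorem exists_gUp_ne_zero [Nonempty (Fin n)] {x : M} (hx : x ∈ φ.source) :
    ∃ k l, gUp g φ (φ x) k l ≠ 0 := by
  by_contra! h
  have h0 : gUp g φ (φ x) = 0 := by ext i j; exact h i j
  have := gUp_mul_gLow hφ g hx
  rw [h0, zero_mul] at this
  exact zero_ne_one this

/-- The symmetric reduced equation `g^{ef}∂ₑ∂_fσ_{ab} + (first order) = R_{ab}` is locally
solvable. -/
theorem exists_symmetric_solution (R : Fin n → Fin n → Model n → ℝ) {x : M} (hx : x ∈ φ.source)
    (hR : ∀ a b, AnalyticAt ℝ (R a b) (φ x)) (hRs : ∀ᶠ u in 𝓝 (φ x), ∀ a b, R a b u = R b a u) :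
    ∃ σ : Fin n → Fin n → Model n → ℝ, (∀ a b, σ a b = σ b a) ∧
      (∀ a b, AnalyticAt ℝ (σ a b) (φ x)) ∧ ∀ᶠ u in 𝓝 (φ x), ∀ a b,
        (∑ e, ∑ f, gUp g φ u e f * pd f (pd e (σ a b)) u)
          + (1 / 2) * (lowerForm g φ u a b (fun c d f => pd f (σ c d) u)
            + lowerForm g φ u b a (fun c d f => pd f (σ c d) u)) = R a b u := by
  -- In dimension zero the inverse metric is an empty matrix and has no nonzero entry, but there is
  -- also nothing to solve.
  rcases isEmpty_or_nonempty (Fin n) with hn | hn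
  · exact ⟨fun _ _ _ => 0, fun _ _ => rfl, fun _ _ => analyticAt_const,
      Eventually.of_forall fun u a => hn.elim a⟩
  -- The system is solved for all pairs of indices without imposing symmetry. Letting the
  -- first-order part see only the symmetrized gradient makes the symmetrization of any solution a
  -- solution as well.
  let T : Model n → Fin n × Fin n → (Fin n → Fin n → Fin n → ℝ) →ₗ[ℝ] ℝ := fun u I =>
    (1 / 2 : ℝ) • ((lowerForm g φ u I.1 I.2 + lowerForm g φ u I.2 I.1) ∘ₗ symmetrizeArray)
  have hT : ∀ u I D, T u I D = (1 / 2) * (lowerForm g φ u I.1 I.2 (symmetrizeArray D)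
      + lowerForm g φ u I.2 I.1 (symmetrizeArray D)) := by
    intro u I D
    simp [T]
  obtain ⟨s, hs, hseq⟩ := exists_analytic_solution (ι := Fin n × Fin n) (φ x)
    (fun k l u => gUp g φ u k l) (fun k l => analyticAt_gUp hφ g hx k l)
    (fun k l => gUp_comm hφ g hx k l) (exists_gUp_ne_zero hφ g hx)
    (fun I J k u => T u I (Pi.single J.1 (Pi.single J.2 (Pi.single k 1))))
    (fun I J k => by
      simp only [hT]
      exact analyticAt_const.mul ((analyticAt_lowerForm hφ g hx _ _ _).add
        (analyticAt_lowerForm hφ g hx _ _ _)))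
    (fun I => R I.1 I.2) (fun I => hR _ _)
  let σ : Fin n → Fin n → Model n → ℝ := fun a b u => (1 / 2) * (s (a, b) u + s (b, a) u)
  refine ⟨σ, fun a b => by funext u; simp only [σ]; ring,
    fun a b => analyticAt_const.mul ((hs _).add (hs _)), ?_⟩
  have han : ∀ᶠ u in 𝓝 (φ x), ∀ I, AnalyticAt ℝ (s I) u :=
    eventually_all.2 fun I => (hs I).eventually_analyticAt
  have hgs := eventually_nhds_chart hx φ.open_source hx
    (P := fun u => ∀ k l, gUp g φ u k l = gUp g φ u l k) fun y hy k l => gUp_comm hφ g hy k l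
  filter_upwards [han.eventually_nhds, hseq, hRs, hgs] with u hu hequ hRu hgu a b
  have hu0 := hu.self_of_nhds
  have hpdσ : ∀ c d f, ∀ w, (∀ I, AnalyticAt ℝ (s I) w) → pd f (σ c d) w =
      (1 / 2) * (pd f (s (c, d)) w + pd f (s (d, c)) w) := by
    intro c d f w hw
    simp only [σ]
    rw [pd_mul f (differentiableAt_const _)
      ((hw _).differentiableAt.fun_add (hw _).differentiableAt), pd_const,
      pd_add f (hw _).differentiableAt (hw _).differentiableAt]
    ring
  have hpd2 : ∀ e f, pd f (pd e (σ a b)) u =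
      (1 / 2) * (pd f (pd e (s (a, b))) u + pd f (pd e (s (b, a))) u) := by
    intro e f
    have : pd e (σ a b) =ᶠ[𝓝 u] fun w => (1 / 2) * (pd e (s (a, b)) w + pd e (s (b, a)) w) := by
      filter_upwards [hu] with w hw
      exact hpdσ a b e w hw
    rw [pd_congr f this, pd_mul f (differentiableAt_const _)
      (((hu0 _).pd e).differentiableAt.fun_add ((hu0 _).pd e).differentiableAt), pd_const,
      pd_add f ((hu0 _).pd e).differentiableAt ((hu0 _).pd e).differentiableAt]
    ring
  have hD : (fun c d f => pd f (σ c d) u) =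
      symmetrizeArray fun c d f => pd f (s (c, d)) u := by
    funext c d f
    exact hpdσ c d f u hu0
  have key : ∀ a b, (∑ e, ∑ f, gUp g φ u e f * pd f (pd e (s (a, b))) u)
      + (1 / 2) * (lowerForm g φ u a b (fun c d f => pd f (σ c d) u)
        + lowerForm g φ u b a (fun c d f => pd f (σ c d) u)) = R a b u := by
    intro a b
    have h1 := hequ (a, b)
    have h2 := sum_single_array (T u (a, b)) (fun c d f => pd f (s (c, d)) u)
    simp only [Prod.mk.eta] at h2
    rw [h2, hT, ← hD] at h1
    rw [← h1]
    congr 1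
    rw [Finset.sum_comm]
    exact Finset.sum_congr rfl fun e _ => Finset.sum_congr rfl fun f _ => by rw [hgu]
  have h1 := key a b
  have h2 := key b a
  rw [hRu b a] at h2
  have h3 : ∑ e, ∑ f, gUp g φ u e f * pd f (pd e (σ a b)) u =
      (1 / 2) * ((∑ e, ∑ f, gUp g φ u e f * pd f (pd e (s (a, b))) u)
        + ∑ e, ∑ f, gUp g φ u e f * pd f (pd e (s (b, a))) u) := by
    simp only [hpd2, Finset.mul_sum, ← Finset.sum_add_distrib, mul_add]
    exact Finset.sum_congr rfl fun e _ => Finset.sum_congr rfl fun f _ => by ring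
  rw [h3]
  linarith

/-- The ansatz is used in a single chart, where `σ` is an array of functions and not a tensor; only
`Y` and `Z`, built from their components by `ofComp`, have to be tensor fields. -/
theorem exists_isRicciPotential (R : TensorField n 2 M) (hR : IsRicciCandidate R)
    (hRan : IsAnalyticField R) {p : M} (hp : p ∈ φ.source) :
    ∃ U : Set M, IsOpen U ∧ p ∈ U ∧ U ⊆ φ.source ∧
      ∃ (Y : TensorField n 3 M) (Z : TensorField n 1 M), IsRicciPotential g φ U R Y Z := by
  have hRcomp : ∀ y ∈ φ.source, ∀ a b : Fin n,
      comp φ R (φ y) ![a, b] = comp φ R (φ y) ![b, a] := by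
    intro y hy a b
    have e : ∀ a b : Fin n, (fun s => coordBasis hφ hy (![a, b] s)) =
        ![coordBasis hφ hy a, coordBasis hφ hy b] := by
      intro a b; funext s; fin_cases s <;> rfl
    rw [comp_eq_coordBasis hφ hy, comp_eq_coordBasis hφ hy, e, e]
    exact hR _ _ _
  obtain ⟨σ, hσs, hσ, hσeq⟩ := exists_symmetric_solution hφ g (fun a b u => comp φ R u ![a, b]) hp
    (fun a b => hRan φ hφ _ p hp)
    (eventually_nhds_chart hp φ.open_source hp
      (P := fun u => ∀ a b, comp φ R u ![a, b] = comp φ R u ![b, a]) hRcomp)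
  have hall : ∀ᶠ u in 𝓝 (φ p), ∀ a b, AnalyticAt ℝ (σ a b) u :=
    eventually_all.2 fun a => eventually_all.2 fun b => (hσ a b).eventually_analyticAt
  obtain ⟨V, hV, hVo, hpV⟩ := eventually_nhds_iff.1 (hall.and hσeq)
  let Y : TensorField n 3 M := ofComp φ fun u I =>
    pd (I 2) (σ (I 0) (I 1)) u - pd (I 1) (σ (I 0) (I 2)) u
  let Z : TensorField n 1 M := ofComp φ fun u I =>
    ∑ e, ∑ f, gUp g φ u e f * pd f (σ (I 0) e) u
  have hYc : ∀ y ∈ φ.source, ∀ I, comp φ Y (φ y) I =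
      pd (I 2) (σ (I 0) (I 1)) (φ y) - pd (I 1) (σ (I 0) (I 2)) (φ y) := fun y hy I =>
    comp_ofComp hφ _ (φ.map_source hy) I
  have hZc : ∀ y ∈ φ.source, ∀ I, comp φ Z (φ y) I =
      ∑ e, ∑ f, gUp g φ (φ y) e f * pd f (σ (I 0) e) (φ y) := fun y hy I =>
    comp_ofComp hφ _ (φ.map_source hy) I
  have hYe : ∀ y ∈ φ.source, ∀ I, (fun u => comp φ Y u I) =ᶠ[𝓝 (φ y)] fun u =>
      pd (I 2) (σ (I 0) (I 1)) u - pd (I 1) (σ (I 0) (I 2)) u := fun y hy I =>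
    eventually_nhds_chart hy φ.open_source hy (P := fun u => comp φ Y u I =
      pd (I 2) (σ (I 0) (I 1)) u - pd (I 1) (σ (I 0) (I 2)) u) fun z hz => hYc z hz I
  have hZe : ∀ y ∈ φ.source, ∀ I, (fun u => comp φ Z u I) =ᶠ[𝓝 (φ y)] fun u =>
      ∑ e, ∑ f, gUp g φ u e f * pd f (σ (I 0) e) u := fun y hy I =>
    eventually_nhds_chart hy φ.open_source hy (P := fun u => comp φ Z u I =
      ∑ e, ∑ f, gUp g φ u e f * pd f (σ (I 0) e) u) fun z hz => hZc z hz I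
  refine ⟨φ.source ∩ φ ⁻¹' V, φ.isOpen_inter_preimage hVo, ⟨hp, hpV⟩, Set.inter_subset_left,
    Y, Z, ?_⟩
  have hYanti : ∀ y ∈ φ.source, ∀ a b c : Fin n,
      comp φ Y (φ y) ![a, b, c] = -comp φ Y (φ y) ![a, c, b] := by
    intro y hy a b c
    rw [hYc y hy, hYc y hy]
    simp
  refine ⟨fun I y hy => ?_, fun I y hy => ?_, fun y hy => antisymm_of_comp hφ hy.1 Y (hYanti y hy.1),
    fun y hy => alternation_eq_zero_of_comp hφ hy.1 Y (hYanti y hy.1) fun a b c => ?_,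
    fun y hy a b => ?_⟩
  · have hs := (hV _ hy.2).1
    exact (((hs _ _).pd _).sub ((hs _ _).pd _)).congr (hYe y hy.1 I).symm
  · have hs := (hV _ hy.2).1
    exact (Finset.analyticAt_fun_sum _ fun e _ => Finset.analyticAt_fun_sum _ fun f _ =>
      (analyticAt_gUp hφ g hy.1 e f).mul ((hs _ _).pd _)).congr (hZe y hy.1 I).symm
  · rw [hYc y hy.1, hYc y hy.1, hYc y hy.1]
    simp [hσs b a, hσs c b, hσs c a]
  · have hys := hy.1
    obtain ⟨hs, heq⟩ := hV _ hy.2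
    have hcY : ∀ a b e f, covD g φ Y (φ y) ![a, b, e] f =
        pd f (pd e (σ a b)) (φ y) - pd f (pd b (σ a e)) (φ y)
        - ((∑ m, christoffel g φ (φ y) m f a * (pd e (σ m b) (φ y) - pd b (σ m e) (φ y)))
          + (∑ m, christoffel g φ (φ y) m f b * (pd e (σ a m) (φ y) - pd m (σ a e) (φ y)))
          + ∑ m, christoffel g φ (φ y) m f e * (pd m (σ a b) (φ y) - pd b (σ a m) (φ y))) := by
      intro a b e f
      rw [covD_three, pd_congr f (hYe y hys _)]
      simp only [hYc y hys]
      rw [pd_sub f ((hs _ _).pd _).differentiableAt ((hs _ _).pd _).differentiableAt]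
      simp
    have hcZ : ∀ a b, covD g φ Z (φ y) ![a] b =
        (∑ e, ∑ f, (pd b (fun u => gUp g φ u e f) (φ y) * pd f (σ a e) (φ y)
          + gUp g φ (φ y) e f * pd f (pd b (σ a e)) (φ y)))
        - ∑ m, christoffel g φ (φ y) m b a *
            ∑ e, ∑ f, gUp g φ (φ y) e f * pd f (σ m e) (φ y) := by
      intro a b
      have hd : ∀ e f, DifferentiableAt ℝ (fun u => gUp g φ u e f) (φ y) := fun e f =>
        (analyticAt_gUp hφ g hys e f).differentiableAt
      have hd' : ∀ e f, DifferentiableAt ℝ (pd f (σ a e)) (φ y) := fun e f =>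
        ((hs _ _).pd _).differentiableAt
      rw [covD_one, pd_congr b (hZe y hys _)]
      simp only [hZc y hys, Matrix.cons_val_zero]
      rw [pd_sum _ _ (fun e _ => by fun_prop)]
      congr 1
      refine Finset.sum_congr rfl fun e _ => ?_
      rw [pd_sum _ _ (fun f _ => by fun_prop)]
      refine Finset.sum_congr rfl fun f _ => ?_
      rw [pd_mul b (hd e f) (hd' e f), pd_comm (hs a e) b f]
    rw [← heq a b]
    -- The cancellation behind the ansatz: the mixed terms `g^{ef}∂_f∂_bσ_{ae}` from `Y` and `Z`
    -- have opposite signs, partial derivatives having been interchanged in `hcZ`.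
    have hhalf : ∀ a b, (∑ e, ∑ f, gUp g φ (φ y) e f * covD g φ Y (φ y) ![a, b, e] f)
        + covD g φ Z (φ y) ![a] b =
        (∑ e, ∑ f, gUp g φ (φ y) e f * pd f (pd e (σ a b)) (φ y))
          + lowerForm g φ (φ y) a b (fun c d f => pd f (σ c d) (φ y)) := by
      intro a b
      rw [lowerForm_apply, hcZ]
      simp only [hcY, mul_sub (gUp g φ (φ y) _ _), Finset.sum_sub_distrib, Finset.sum_add_distrib]
      ring
    have h1 := hhalf a b
    have h2 := hhalf b a
    rw [hσs b a] at h2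
    linarith

end RicciPotential

end

theorem mainTheorem9 (n : ℕ) (M : Type*) [TopologicalSpace M] [ChartedSpace (Model n) M]
    [IsManifold (𝓡 n) ω M] (g : AnalyticMetric n M)
    (φ : OpenPartialHomeomorph M (Model n)) (hφ : φ ∈ IsManifold.maximalAtlas (𝓡 n) ω M)
    (R : TensorField n 2 M) (hR : IsRicciCandidate R) :
    (IsAnalyticField R → ∀ p ∈ φ.source, ∃ U : Set M, IsOpen U ∧ p ∈ U ∧ U ⊆ φ.source ∧
      ∃ (Y : TensorField n 3 M) (Z : TensorField n 1 M), IsRicciPotential g φ U R Y Z) ∧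
    (∀ U : Set M, IsOpen U → U ⊆ φ.source →
      ∀ R' : TensorField n 4 M, IsRiemannCandidate R' → IsRicciTrace g φ U R' R →
      ∀ (Y' : TensorField n 5 M) (Z' : TensorField n 3 M), IsRiemannPotential g φ U R' Y' Z' →
        (∃ (Y : TensorField n 3 M) (Z : TensorField n 1 M),
          IsPotentialTrace g φ U Y' Z' Y Z) ∧
        ∀ (Y : TensorField n 3 M) (Z : TensorField n 1 M),
          IsPotentialTrace g φ U Y' Z' Y Z → IsRicciPotential g φ U R Y Z) := by
  refine ⟨fun hRan p hp => exists_isRicciPotential hφ g R hR hRan hp,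
    fun U hU hUs R' _ hTr Y' Z' hP => ⟨exists_isPotentialTrace hφ g hUs Y' Z', fun Y Z hT =>
      hT.isRicciPotential hφ hU hUs hTr hP⟩⟩
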